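/- Let $m\ge 3$ and let $Q^{*m}=SO^0_{2,m}/SO_2SO_m$ be the complex hyperbolic quadric, with its invariant Riemannian metric $g$ (at the base point $g(X,Y)=\frac12\operatorname{tr}(Y^tX)$ on $\mathfrak m\subset\mathfrak{so}_{2,m}$), its complex structure $J$, and its $S^1$-bundle $\mathfrak A$ of real structures: at the base point $\mathfrak A=\{(\cos\theta+\sin\theta\,J)A_0:\theta\in\mathbb R\}$ with $A_0=\mathrm{Ad}(\operatorname{diag}(1,-1,1,\dots,1))$, and $\mathfrak A$ is invariant under $SO^0_{2,m}$. A nonzero tangent vector $V$ of $Q^{*m}$ at $p$ is called $\mathfrak A$-principal if $AV=V$ for some $A\in\mathfrak A_p$. Let $M$ be a nonempty real hypersurface of $Q^{*m}$ (a smoothly immersed manifold of real dimension $2m-1$). For a (local) unit normal vector field $N$ of $M$, let $S X=-\bar\nabla_XN$ be the shape operator ($\bar\nabla$ the Levi-Civita connection of $Q^{*m}$), $\xi=-JN$ the Reeb vector field, $\alpha=g(S\xi,\xi)$ the Reeb curvature function, $\nabla$ and $R$ the Levi-Civita connection and the curvature tensor of $M$, and $R_\xi X=R(X,\xi)\xi$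 the structure Jacobi operator. Then the following four properties cannot all hold on $M$: 1. $M$ is Hopf: $S\xi=\alpha\xi$; 2. the Reeb curvature is non-vanishing: $\alpha\neq 0$ everywhere; 3. the structure Jacobi operator is Reeb parallel: $\nabla_\xi R_\xi=0$; 4. the unit normal $N$ is $\mathfrak A$-principal at every point. In other words, there does not exist a Hopf real hypersurface in $Q^{*m}$, $m\ge 3$, with non-vanishing Reeb curvature, Reeb parallel structure Jacobi operator and $\mathfrak A$-principal unit normal vector field. (The four properties do not depend on the choice of the sign of $N$.) -/

import Mathlib

open scoped Manifold ContDiff Topology Matrix.Norms.L2Operator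

namespace ComplexHyperbolicQuadric

/-- Real square matrices of size `m + 2`, written in blocks with respect to `ℝ² ⊕ ℝᵐ`.
Any norm on this space gives the same smooth structure; the operator norm is used, for which it is
a normed algebra. -/
abbrev Mat (m : ℕ) : Type := Matrix (Fin 2 ⊕ Fin m) (Fin 2 ⊕ Fin m) ℝ

noncomputable section

/-! ### The complex hyperbolic quadric `SO⁰(2,m) / SO(2) SO(m)`

It is realised as the adjoint orbit of `SO⁰(2,m)` through the element `base m` of the centre
of the Lie algebra of `SO(2) SO(m)`; the stabiliser of `base m` is exactly `SO(2) SO(m)`, so the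
orbit is the quotient `G / K`, embedded in `Mat m`. -/

/-- The matrix `s = diag(-1, -1, 1, …, 1)`. -/
def signature (m : ℕ) : Mat m := Matrix.fromBlocks (-1) 0 0 1

/-- The group `SO(2,m)`, as a set of matrices. -/
def specialOrthogonal (m : ℕ) : Set (Mat m) :=
  {h | h.transpose * signature m * h = signature m ∧ h.det = 1}

/-- The identity component `G = SO⁰(2,m)`. -/
def transvections (m : ℕ) : Set (Mat m) :=
  connectedComponentIn (specialOrthogonal m) 1

/-- The Lie algebra `so(2,m)`, as a set of matrices. -/
def lieAlg (m : ℕ) : Set (Mat m) :=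
  {X | X.transpose * signature m = -(signature m * X)}

/-- The base point: `!![0, 1; -1, 0]` on `ℝ²` and `0` on `ℝᵐ`. -/
def base (m : ℕ) : Mat m := Matrix.fromBlocks !![0, 1; -1, 0] 0 0 0

/-- The complex hyperbolic quadric `Q*ᵐ`: the orbit of `base m` under conjugation by `G`. -/
def quadric (m : ℕ) : Set (Mat m) :=
  {W | ∃ h ∈ transvections m, W = h * base m * h⁻¹}

/-- The tangent space of `Q*ᵐ` at `W`, the image of `so(2,m)` under the differential
`X ↦ [X, W]` of the orbit map. At `base m` this is the space `𝔪` of the Cartan decomposition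
`so(2,m) = 𝔨 ⊕ 𝔪`, and at `h * base m * h⁻¹` it is `h 𝔪 h⁻¹`. -/
def tangentSet {m : ℕ} (W : Mat m) : Set (Mat m) :=
  {V | ∃ X ∈ lieAlg m, V = ⁅X, W⁆}

/-- The Riemannian metric `g(X, Y) = (1/2) tr (X Y)` on the tangent spaces of `Q*ᵐ`. It is
invariant under conjugation, and elements of `𝔪` are symmetric, so at `base m` it is
`(1/2) tr (Yᵀ X)`. -/
def metric {m : ℕ} (X Y : Mat m) : ℝ := (X * Y).trace / 2

/-- The complex structure `J` of `Q*ᵐ` at `W`. At `base m` one has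
`[base m, X] = j X j⁻¹` for `X ∈ 𝔪`, where `j` is `!![0, 1; -1, 0]` on `ℝ²` and `1` on `ℝᵐ`. -/
def J {m : ℕ} (W X : Mat m) : Mat m := ⁅W, X⁆

/-- The matrix `a₀ = diag(1, -1, 1, …, 1)`. -/
def reflection (m : ℕ) : Mat m := Matrix.fromBlocks !![1, 0; 0, -1] 0 0 1

/-- The circle `𝔄` of real structures at `W`: for `W = h * base m * h⁻¹` with `h ∈ G`, it consists
of the maps `λ A`, where `λ = cos θ + i sin θ` acts through `J` and `A` is the transport by
`h` of the real structure `X ↦ a₀ X a₀⁻¹` at the base point. -/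
def realStructures {m : ℕ} (W : Mat m) : Set (Mat m → Mat m) :=
  {A | ∃ h ∈ transvections m, W = h * base m * h⁻¹ ∧ ∃ θ : ℝ, ∀ X : Mat m,
    A X = Real.cos θ • ((h * reflection m * h⁻¹) * X * (h * reflection m * h⁻¹)⁻¹) +
      Real.sin θ • J W ((h * reflection m * h⁻¹) * X * (h * reflection m * h⁻¹)⁻¹)}

/-- A nonzero tangent vector `V` of `Q*ᵐ` at `W` is `𝔄`-principal if it is fixed by some real
structure of the circle `𝔄`. -/
def IsPrincipal {m : ℕ} (W V : Mat m) : Prop :=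
  V ∈ tangentSet W ∧ V ≠ 0 ∧ ∃ A ∈ realStructures W, A V = V

/-! ### Real hypersurfaces

Throughout, `f : M → Mat m` is an immersion of a manifold of dimension `2 m - 1` into `Q*ᵐ`.
Tangent vectors of `M` at `q` are identified with their images under the differential of `f`,
so vector fields on `M`, as well as vector fields along `f`, are maps `M → Mat m`. -/

variable {m : ℕ} {M : Type*} [TopologicalSpace M]
  [ChartedSpace (EuclideanSpace ℝ (Fin (2 * m - 1))) M]

/-- A (smoothly immersed) real hypersurface of `Q*ᵐ`. -/
structure IsRealHypersurface (f : M → Mat m) : Prop where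
  smooth : ContMDiff (𝓡 (2 * m - 1)) 𝓘(ℝ, Mat m) ∞ f
  mem_quadric : ∀ q, f q ∈ quadric m
  immersion : ∀ q, Function.Injective (mvfderiv (𝓡 (2 * m - 1)) f q)

/-- The tangent space of the hypersurface at `q`, as a subspace of that of `Q*ᵐ` at `f q`. -/
def tangentPlane (f : M → Mat m) (q : M) : Set (Mat m) :=
  Set.range (mvfderiv (𝓡 (2 * m - 1)) f q)

/-- `N` is a smooth unit normal vector field of the hypersurface on `U`. -/
structure IsUnitNormalOn (f N : M → Mat m) (U : Set M) : Prop where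
  smooth : ContMDiffOn (𝓡 (2 * m - 1)) 𝓘(ℝ, Mat m) ∞ N U
  tangent : ∀ q ∈ U, N q ∈ tangentSet (f q)
  unit : ∀ q ∈ U, metric (N q) (N q) = 1
  normal : ∀ q ∈ U, ∀ V ∈ tangentPlane f q, metric V (N q) = 0

/-- `X` is, near `q`, a smooth vector field tangent to the hypersurface. -/
def IsTangentFieldNear (f X : M → Mat m) (q : M) : Prop :=
  ∀ᶠ q' in 𝓝 q, ContMDiffAt (𝓡 (2 * m - 1)) 𝓘(ℝ, Mat m) ∞ X q' ∧ X q' ∈ tangentPlane f q'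

/-- The directional derivative `D_X Y` in the vector space `Mat m` of a map `Y` on `M` along a
vector field `X` tangent to the hypersurface. -/
def flatDeriv (f X Y : M → Mat m) (q : M) : Mat m :=
  mvfderiv (𝓡 (2 * m - 1)) Y q
    (Function.invFun (mvfderiv (𝓡 (2 * m - 1)) f q) (X q))

/-- The Lie bracket of vector fields tangent to the hypersurface, `[X, Y] = D_X Y - D_Y X`. -/
def bracket (f X Y : M → Mat m) (q : M) : Mat m :=
  flatDeriv f X Y q - flatDeriv f Y X q

/-- The Levi-Civita derivative of `Q*ᵐ` of a vector field `Y` along `f`, in the direction `X`: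
the component of `D_X Y` tangent to `Q*ᵐ`. At `W ∈ Q*ᵐ` the map `V ↦ -[W, [W, V]]` is the
projection of `so(2,m)` onto the tangent space of `Q*ᵐ`, orthogonal for the trace form; the metric
of `Q*ᵐ` is the restriction of `(1/2) tr (X Y)`. -/
def ambientNabla (f X Y : M → Mat m) (q : M) : Mat m :=
  -⁅f q, ⁅f q, flatDeriv f X Y q⁆⁆

/-- The shape operator, by the Weingarten formula `S X = -∇̄_X N`. -/
def shape (f N X : M → Mat m) (q : M) : Mat m := -ambientNabla f X N q

/-- The Levi-Civita derivative of the hypersurface for the induced metric, by the Gauss formula: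
the component of `∇̄_X Y` tangent to the hypersurface. -/
def nabla (f N X Y : M → Mat m) (q : M) : Mat m :=
  ambientNabla f X Y q - metric (ambientNabla f X Y q) (N q) • N q

/-- The Riemannian curvature tensor of the hypersurface,
`R(X,Y)Z = ∇_X ∇_Y Z - ∇_Y ∇_X Z - ∇_[X,Y] Z`. -/
def curvature (f N X Y Z : M → Mat m) (q : M) : Mat m :=
  nabla f N X (nabla f N Y Z) q - nabla f N Y (nabla f N X Z) q - nabla f N (bracket f X Y) Z q

/-- The Reeb vector field `ξ = -J N`. -/
def reeb (f N : M → Mat m) (q : M) : Mat m := -J (f q) (N q)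

/-- The Reeb curvature function `α = g(S ξ, ξ)`. -/
def reebCurvature (f N : M → Mat m) (q : M) : ℝ :=
  metric (shape f N (reeb f N) q) (reeb f N q)

/-- The Hopf condition `S ξ = α ξ` at `q`. -/
def IsHopfAt (f N : M → Mat m) (q : M) : Prop :=
  shape f N (reeb f N) q = reebCurvature f N q • reeb f N q

/-- The structure Jacobi operator `R_ξ X = R(X, ξ) ξ`. -/
def structureJacobi (f N X : M → Mat m) : M → Mat m :=
  curvature f N X (reeb f N) (reeb f N)

/-- The structure Jacobi operator is Reeb parallel at `q`: for every vector field `X` tangent to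
the hypersurface, `(∇_ξ R_ξ) X = ∇_ξ (R_ξ X) - R_ξ (∇_ξ X)` vanishes at `q`. -/
def IsReebParallelAt (f N : M → Mat m) (q : M) : Prop :=
  ∀ X : M → Mat m, IsTangentFieldNear f X q →
    nabla f N (reeb f N) (structureJacobi f N X) q -
      structureJacobi f N (nabla f N (reeb f N) X) q = 0

end

end ComplexHyperbolicQuadric

open ComplexHyperbolicQuadric

/-!
A point `W` of the quadric is an oriented negative definite plane for the form of signature
`(2, m)`. If this plane has the orthonormal basis `e₁, e₂` (`IsFrame`), then `W = -e₁ ∧ e₂`, and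
the tangent vectors at `W` are the elements `e₁ ∧ x₁ + e₂ ∧ x₂` of `so(2, m)` with `x₁, x₂`
orthogonal to the plane; `J` maps `(x₁, x₂)` to `(x₂, -x₁)`. An `𝔄`-principal unit normal is, in a
suitable frame, `N = e₁ ∧ v` with `⟨v, v⟩ = 1` (`IsPrincipal.exists_isAdapted`), and then
`ξ = e₂ ∧ v`. The real structure fixing `N` is `+1` on the vectors `e₁ ∧ x` and `-1` on the
vectors `e₂ ∧ x`.

Differentiating the identity `N W N = 0`, which holds for every such normal, shows that the shape
operator maps `e₁ ∧ x₁ + e₂ ∧ x₂` to `e₁ ∧ s + θ (e₂ ∧ v)` (`exists_weingarten`), and by its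
symmetry and the Hopf condition `θ = α ⟨x₂, v⟩` (`theta_eq`). The same number `θ` is the rotation
speed of the real structure that fixes the normal: with `P = -e₁ ⊗ e₁ = -W² N²`, one has
`tr (dP W P) = α η`, where `η` is dual to `ξ` (`trace_dproj`). Exterior differentiation of this
identity of one-forms (`ext_deriv_eq`) needs no bracket of vector fields, as tangent vectors have
commuting extensions. On the orthogonal complement of `ξ` the left-hand side yields the Kähler
form up to a factor and the right-hand side `α dη`, the term `dα ∧ η` being zero there. Hence
`α s = x₁` (`smul_s_eq`), so that the shape operator is `α⁻¹` on the vectors `e₁ ∧ x₁`, `0` on the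
vectors `e₂ ∧ x₂` with `x₂ ⟂ v`, and `α` on `ξ`.

Therefore `∇_Z ξ = -α⁻¹ e₂ ∧ x₁` for `Z = e₁ ∧ x₁ + e₂ ∧ x₂` (`deriv_reeb`). Let `X = e₂ ∧ x` be a
vector field with `x ⟂ v`, which exists because of `m ≥ 2`. Because the real structure rotates,
`∇_ξ X = α e₁ ∧ x + e₂ ∧ z` for some `z ⟂ v` (`deriv_antiInvariant`). Evaluating the definition of
the curvature gives `R_ξ X = -X` for every such field, whereas in
`(∇_ξ R_ξ) X = -∇_ξ X - R_ξ (∇_ξ X)` the component `e₁ ∧ ·` is `-2 α e₁ ∧ x`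
(`not_isReebParallelAt`), and this is not zero.
-/

set_option linter.unusedSimpArgs false

namespace ComplexHyperbolicQuadric

open Matrix

section Algebra

variable {m : ℕ}

/-! ### The form of signature `(2, m)` and its Lie algebra -/

/-- The bilinear form of signature `(2, m)` on `ℝ^(2+m)`. -/
noncomputable def lform (u w : Fin 2 ⊕ Fin m → ℝ) : ℝ := u ⬝ᵥ (signature m *ᵥ w)

/-- The rank one endomorphism `x ↦ ⟨w, x⟩ u`, for the form of signature `(2, m)`. -/
noncomputable def tens (u w : Fin 2 ⊕ Fin m → ℝ) : Mat m := vecMulVec u (signature m *ᵥ w)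

/-- The element `u ∧ w : x ↦ ⟨w, x⟩ u - ⟨u, x⟩ w` of `so(2, m)`. -/
noncomputable def wedge (u w : Fin 2 ⊕ Fin m → ℝ) : Mat m := tens u w - tens w u

theorem signature_transpose : (signature m)ᵀ = signature m := by
  simp [signature, fromBlocks_transpose]

theorem signature_mul_self : signature m * signature m = 1 := by
  simp [signature, fromBlocks_multiply]

theorem lform_comm (u w : Fin 2 ⊕ Fin m → ℝ) : lform u w = lform w u := by
  unfold lform
  rw [dotProduct_mulVec, ← mulVec_transpose, signature_transpose, dotProduct_comm]

@[simp] theorem lform_add_left (u u' w : Fin 2 ⊕ Fin m → ℝ) :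
    lform (u + u') w = lform u w + lform u' w := by simp [lform]
@[simp] theorem lform_add_right (u w w' : Fin 2 ⊕ Fin m → ℝ) :
    lform u (w + w') = lform u w + lform u w' := by simp [lform, mulVec_add]
@[simp] theorem lform_sub_left (u u' w : Fin 2 ⊕ Fin m → ℝ) :
    lform (u - u') w = lform u w - lform u' w := by simp [lform]
@[simp] theorem lform_sub_right (u w w' : Fin 2 ⊕ Fin m → ℝ) :
    lform u (w - w') = lform u w - lform u w' := by simp [lform, mulVec_sub]
@[simp] theorem lform_neg_left (u w : Fin 2 ⊕ Fin m → ℝ) :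
    lform (-u) w = -lform u w := by simp [lform]
@[simp] theorem lform_neg_right (u w : Fin 2 ⊕ Fin m → ℝ) :
    lform u (-w) = -lform u w := by simp [lform, mulVec_neg]
@[simp] theorem lform_smul_left (c : ℝ) (u w : Fin 2 ⊕ Fin m → ℝ) :
    lform (c • u) w = c * lform u w := by simp [lform]
@[simp] theorem lform_smul_right (c : ℝ) (u w : Fin 2 ⊕ Fin m → ℝ) :
    lform u (c • w) = c * lform u w := by simp [lform, mulVec_smul]
@[simp] theorem lform_zero_left (w : Fin 2 ⊕ Fin m → ℝ) : lform 0 w = 0 := by simp [lform]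
@[simp] theorem lform_zero_right (w : Fin 2 ⊕ Fin m → ℝ) : lform w 0 = 0 := by simp [lform]

@[simp] theorem tens_add_left (u u' w : Fin 2 ⊕ Fin m → ℝ) :
    tens (u + u') w = tens u w + tens u' w := by simp [tens, add_vecMulVec]
@[simp] theorem tens_add_right (u w w' : Fin 2 ⊕ Fin m → ℝ) :
    tens u (w + w') = tens u w + tens u w' := by simp [tens, mulVec_add, vecMulVec_add]
@[simp] theorem tens_sub_left (u u' w : Fin 2 ⊕ Fin m → ℝ) :
    tens (u - u') w = tens u w - tens u' w := by simp [tens, sub_vecMulVec]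
@[simp] theorem tens_sub_right (u w w' : Fin 2 ⊕ Fin m → ℝ) :
    tens u (w - w') = tens u w - tens u w' := by simp [tens, mulVec_sub, vecMulVec_sub]
@[simp] theorem tens_smul_left (c : ℝ) (u w : Fin 2 ⊕ Fin m → ℝ) :
    tens (c • u) w = c • tens u w := by simp [tens, smul_vecMulVec]
@[simp] theorem tens_smul_right (c : ℝ) (u w : Fin 2 ⊕ Fin m → ℝ) :
    tens u (c • w) = c • tens u w := by simp [tens, mulVec_smul, vecMulVec_smul]
@[simp] theorem tens_neg_left (u w : Fin 2 ⊕ Fin m → ℝ) :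
    tens (-u) w = -tens u w := by simp [tens, neg_vecMulVec]
@[simp] theorem tens_neg_right (u w : Fin 2 ⊕ Fin m → ℝ) :
    tens u (-w) = -tens u w := by simp [tens, mulVec_neg, vecMulVec_neg]
@[simp] theorem tens_zero_left (w : Fin 2 ⊕ Fin m → ℝ) : tens 0 w = 0 := by simp [tens]
@[simp] theorem tens_zero_right (w : Fin 2 ⊕ Fin m → ℝ) : tens w 0 = 0 := by simp [tens]

theorem tens_mul_tens (u w x y : Fin 2 ⊕ Fin m → ℝ) :
    tens u w * tens x y = lform w x • tens u y := by
  rw [lform_comm]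
  simp [tens, lform, vecMulVec_mul_vecMulVec, dotProduct_comm]

theorem trace_tens (u w : Fin 2 ⊕ Fin m → ℝ) : (tens u w).trace = lform u w := by
  simp [tens, lform, trace_vecMulVec]

theorem mul_tens (A : Mat m) (u w : Fin 2 ⊕ Fin m → ℝ) :
    A * tens u w = tens (A *ᵥ u) w := by
  simp [tens, mul_vecMulVec]

theorem tens_mul {A : Mat m} (hA : A ∈ lieAlg m) (u w : Fin 2 ⊕ Fin m → ℝ) :
    tens u w * A = -tens u (A *ᵥ w) := by
  have h : Aᵀ * signature m = -(signature m * A) := hA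
  simp only [tens, vecMulVec_mul]
  rw [← mulVec_transpose, mulVec_mulVec, h, neg_mulVec, vecMulVec_neg, mulVec_mulVec]

theorem tens_mulVec (u w x : Fin 2 ⊕ Fin m → ℝ) : tens u w *ᵥ x = lform w x • u := by
  rw [lform_comm, tens, vecMulVec_mulVec, lform, dotProduct_comm]
  ext i; simp [mul_comm]

theorem lform_lieAlg {A : Mat m} (hA : A ∈ lieAlg m) (u w : Fin 2 ⊕ Fin m → ℝ) :
    lform (A *ᵥ u) w = -lform u (A *ᵥ w) := by
  have h : Aᵀ * signature m = -(signature m * A) := hA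
  rw [lform, lform, ← vecMul_transpose, ← dotProduct_mulVec, mulVec_mulVec, h, mulVec_mulVec,
    neg_mulVec, dotProduct_neg]

theorem wedge_mem_lieAlg (u w : Fin 2 ⊕ Fin m → ℝ) : wedge u w ∈ lieAlg m := by
  simp only [lieAlg, Set.mem_ofPred_eq, wedge, tens, transpose_sub, transpose_vecMulVec,
    vecMulVec_mul, sub_mul, mul_sub, mul_vecMulVec, ← mulVec_transpose, signature_transpose,
    neg_sub]

/-- The Lie algebra `so(2, m)`, as a linear subspace. -/
noncomputable def lieAlgSubmodule (m : ℕ) : Submodule ℝ (Mat m) where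
  carrier := lieAlg m
  add_mem' := by
    intro a b ha hb
    simp only [lieAlg, Set.mem_ofPred_eq] at *
    rw [transpose_add, add_mul, ha, hb, mul_add]; abel
  zero_mem' := by simp [lieAlg]
  smul_mem' := by
    intro c a ha
    simp only [lieAlg, Set.mem_ofPred_eq] at *
    rw [transpose_smul, smul_mul_assoc, ha, mul_smul_comm, smul_neg]

theorem lie_mem_lieAlg {A B : Mat m} (hA : A ∈ lieAlg m) (hB : B ∈ lieAlg m) :
    ⁅A, B⁆ ∈ lieAlg m := by
  simp only [lieAlg, Set.mem_ofPred_eq, Ring.lie_def] at *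
  rw [transpose_sub, transpose_mul, transpose_mul, sub_mul, mul_assoc, mul_assoc, hA, hB,
    mul_neg, mul_neg, ← mul_assoc, ← mul_assoc, hA, hB]
  noncomm_ring

/-! ### Points and tangent vectors of the quadric -/

/-- An orthonormal pair spanning the negative definite plane of the point `W` of the quadric. -/
structure IsFrame (W : Mat m) (e₁ e₂ : Fin 2 ⊕ Fin m → ℝ) : Prop where
  eq : W = -wedge e₁ e₂
  e11 : lform e₁ e₁ = -1
  e22 : lform e₂ e₂ = -1
  e12 : lform e₁ e₂ = 0
  pos : ∀ x, lform e₁ x = 0 → lform e₂ x = 0 → x ≠ 0 → 0 < lform x x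

theorem conj_tens {h : Mat m} (hh : hᵀ * signature m * h = signature m)
    (u w : Fin 2 ⊕ Fin m → ℝ) : h * tens u w * h⁻¹ = tens (h *ᵥ u) (h *ᵥ w) := by
  have h1 : (signature m * hᵀ * signature m) * h = 1 := by
    rw [mul_assoc, mul_assoc, ← mul_assoc hᵀ, hh, signature_mul_self]
  have h2 : h⁻¹ = signature m * hᵀ * signature m := inv_eq_left_inv h1
  rw [mul_tens, h2, tens, tens, vecMulVec_mul, ← mulVec_transpose]
  congr 1
  simp only [transpose_mul, transpose_transpose, signature_transpose, mulVec_mulVec, mul_assoc]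
  rw [signature_mul_self, mul_one]

theorem lform_conj {h : Mat m} (hh : hᵀ * signature m * h = signature m)
    (u w : Fin 2 ⊕ Fin m → ℝ) : lform (h *ᵥ u) (h *ᵥ w) = lform u w := by
  conv_rhs => rw [lform, ← hh]
  rw [lform, ← vecMul_transpose, ← dotProduct_mulVec, mulVec_mulVec, mulVec_mulVec, mul_assoc]

/-- The `i`-th standard basis vector of the negative definite plane of the base point. -/
def stdNeg (m : ℕ) (i : Fin 2) : Fin 2 ⊕ Fin m → ℝ := Pi.single (Sum.inl i) 1

theorem signature_mulVec_stdNeg (i : Fin 2) : signature m *ᵥ stdNeg m i = -stdNeg m i := by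
  ext j
  rcases j with j | j <;> fin_cases i <;>
    simp [stdNeg, signature, Matrix.one_apply, Pi.single_apply]

theorem base_eq : base m = -wedge (stdNeg m 0) (stdNeg m 1) := by
  simp only [wedge, tens, signature_mulVec_stdNeg]
  ext i j
  rcases i with i | i <;> rcases j with j | j <;>
    simp [base, stdNeg, vecMulVec_apply, Pi.single_apply]
  fin_cases i <;> fin_cases j <;> simp

theorem reflection_eq : reflection m = 1 + (2 : ℝ) • tens (stdNeg m 1) (stdNeg m 1) := by
  simp only [tens, signature_mulVec_stdNeg]
  ext i j
  rcases i with i | i <;> rcases j with j | j <;>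
    simp [reflection, stdNeg, vecMulVec_apply, Pi.single_apply, Matrix.one_apply]
  fin_cases i <;> fin_cases j <;> norm_num

theorem lform_stdNeg (i : Fin 2) (x : Fin 2 ⊕ Fin m → ℝ) :
    lform (stdNeg m i) x = -x (Sum.inl i) := by
  rw [lform_comm, lform, signature_mulVec_stdNeg]
  simp [stdNeg]

theorem base_isFrame : IsFrame (base m) (stdNeg m 0) (stdNeg m 1) where
  eq := base_eq
  e11 := by rw [lform_stdNeg]; simp [stdNeg]
  e22 := by rw [lform_stdNeg]; simp [stdNeg]
  e12 := by rw [lform_stdNeg]; simp [stdNeg]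
  pos := by
    intro x h1 h2 hx
    rw [lform_stdNeg, neg_eq_zero] at h1 h2
    have key : lform x x = ∑ i : Fin m, x (Sum.inr i) * x (Sum.inr i) := by
      simp [lform, signature, dotProduct, mulVec, fromBlocks, h1, h2, Matrix.one_apply]
    rw [key]
    have hne : ∃ i, x (Sum.inr i) ≠ 0 := by
      by_contra! hc
      refine hx (funext fun j => ?_)
      rcases j with j | j
      · fin_cases j <;> assumption
      · exact hc j
    obtain ⟨i, hi⟩ := hne
    exact Finset.sum_pos' (fun _ _ => mul_self_nonneg _) ⟨i, Finset.mem_univ _, mul_self_pos.mpr hi⟩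

theorem conj_isFrame {h : Mat m} (hh : hᵀ * signature m * h = signature m) :
    IsFrame (h * base m * h⁻¹) (h *ᵥ stdNeg m 0) (h *ᵥ stdNeg m 1) where
  eq := by
    rw [base_eq, wedge, wedge, mul_neg, neg_mul, mul_sub, sub_mul, conj_tens hh, conj_tens hh]
  e11 := by rw [lform_conj hh, base_isFrame.e11]
  e22 := by rw [lform_conj hh, base_isFrame.e22]
  e12 := by rw [lform_conj hh, base_isFrame.e12]
  pos := by
    intro x h1 h2 hx
    have h0 : (signature m * hᵀ * signature m) * h = 1 := by
      rw [mul_assoc, mul_assoc, ← mul_assoc hᵀ, hh, signature_mul_self]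
    have h3 : h * (signature m * hᵀ * signature m) = 1 := mul_eq_one_comm.mp h0
    obtain ⟨y, rfl⟩ : ∃ y, h *ᵥ y = x := ⟨(signature m * hᵀ * signature m) *ᵥ x, by
      rw [mulVec_mulVec, h3, one_mulVec]⟩
    rw [lform_conj hh] at *
    exact base_isFrame.pos y h1 h2 (by rintro rfl; simp at hx)

theorem transvections_spec {h : Mat m} (hh : h ∈ transvections m) :
    hᵀ * signature m * h = signature m :=
  (connectedComponentIn_subset _ _ hh).1

theorem exists_isFrame {W : Mat m} (hW : W ∈ quadric m) : ∃ e₁ e₂, IsFrame W e₁ e₂ := by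
  obtain ⟨h, hh, rfl⟩ := hW
  exact ⟨_, _, conj_isFrame (transvections_spec hh)⟩

theorem IsFrame.mem_lieAlg {W : Mat m} {e₁ e₂ : Fin 2 ⊕ Fin m → ℝ} (h : IsFrame W e₁ e₂) :
    W ∈ lieAlg m := by
  rw [h.eq]; exact (lieAlgSubmodule m).neg_mem (wedge_mem_lieAlg _ _)

theorem IsFrame.mul_self {W : Mat m} {e₁ e₂ : Fin 2 ⊕ Fin m → ℝ} (h : IsFrame W e₁ e₂) :
    W * W = tens e₁ e₁ + tens e₂ e₂ := by
  rw [h.eq]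
  simp only [wedge, neg_sub, mul_sub, sub_mul, tens_mul_tens, h.e11, h.e22, h.e12,
    lform_comm e₂ e₁]
  module

theorem IsFrame.cube {W : Mat m} {e₁ e₂ : Fin 2 ⊕ Fin m → ℝ} (h : IsFrame W e₁ e₂) :
    W * W * W = -W := by
  rw [h.mul_self, h.eq]
  simp only [wedge, neg_sub, mul_sub, add_mul, tens_mul_tens, h.e11, h.e22, h.e12,
    lform_comm e₂ e₁]
  module

/-- The vector `x` is orthogonal to `e₁` and `e₂`. -/
structure IsPerp (e₁ e₂ x : Fin 2 ⊕ Fin m → ℝ) : Prop where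
  e1x : lform e₁ x = 0
  e2x : lform e₂ x = 0

theorem IsPerp.xe1 {e₁ e₂ x : Fin 2 ⊕ Fin m → ℝ} (h : IsPerp e₁ e₂ x) : lform x e₁ = 0 := by
  rw [lform_comm, h.e1x]
theorem IsPerp.xe2 {e₁ e₂ x : Fin 2 ⊕ Fin m → ℝ} (h : IsPerp e₁ e₂ x) : lform x e₂ = 0 := by
  rw [lform_comm, h.e2x]

/-- The tangent space of the quadric at `W` consists of the elements `e₁ ∧ x₁ + e₂ ∧ x₂` with
`x₁`, `x₂` orthogonal to `e₁`, `e₂`; the equation defining it is the derivative of `W³ = -W`. -/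
theorem IsFrame.exists_wedge {W V : Mat m} {e₁ e₂ : Fin 2 ⊕ Fin m → ℝ} (h : IsFrame W e₁ e₂)
    (hV : V ∈ lieAlg m) (hWV : V * W * W + W * V * W + W * W * V = -V) :
    ∃ x₁ x₂, IsPerp e₁ e₂ x₁ ∧ IsPerp e₁ e₂ x₂ ∧ V = wedge e₁ x₁ + wedge e₂ x₂ := by
  have sk : ∀ u w, lform u (V *ᵥ w) = -lform w (V *ᵥ u) := fun u w => by
    rw [lform_comm, lform_lieAlg hV]
  have s1 : lform e₁ (V *ᵥ e₁) = 0 := by linarith [sk e₁ e₁]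
  have s2 : lform e₂ (V *ᵥ e₂) = 0 := by linarith [sk e₂ e₂]
  have h21 : lform e₂ e₁ = 0 := by rw [lform_comm, h.e12]
  have e : V * (W * W) + W * V * W + W * W * V = -V := by rw [← mul_assoc]; exact hWV
  rw [h.mul_self] at e
  have e' : (V * (tens e₁ e₁ + tens e₂ e₂) + W * V * W + (tens e₁ e₁ + tens e₂ e₂) * V) *ᵥ e₂
      = (-V) *ᵥ e₂ := by rw [e]
  rw [h.eq] at e e'
  -- The `e₁`-component of the equation at `e₂` kills the part of `V` rotating the plane.
  have c : lform e₁ (V *ᵥ e₂) = 0 := by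
    have e'' := congrArg (lform e₁) e'
    simp only [wedge, neg_sub, mul_add, add_mul, mul_sub, sub_mul, mul_tens, tens_mul hV, neg_mul,
      add_mulVec, sub_mulVec, neg_mulVec, tens_mulVec, lform_add_right, lform_neg_right,
      lform_sub_right, lform_smul_right, tens_smul_left, tens_neg_left, smul_mulVec, tens_neg_right,
      lform_neg_left, lform_lieAlg hV _ e₁, lform_lieAlg hV _ e₂,
      h.e11, h.e12, h.e22, h21, s1, s2, sk e₂ e₁] at e''
    linarith
  have c' : lform e₂ (V *ᵥ e₁) = 0 := by rw [sk, c, neg_zero]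
  refine ⟨V *ᵥ e₁, V *ᵥ e₂, ⟨s1, c'⟩, ⟨c, s2⟩, ?_⟩
  rw [← neg_inj, ← e]
  simp only [wedge, neg_sub, mul_add, add_mul, mul_sub, sub_mul, mul_tens, tens_mul hV, neg_mul,
      neg_mulVec, tens_mulVec, tens_smul_left, lform_lieAlg hV _ e₁, lform_lieAlg hV _ e₂,
      c, c', s1, s2]
  module

theorem IsFrame.e21 {W : Mat m} {e₁ e₂ : Fin 2 ⊕ Fin m → ℝ} (h : IsFrame W e₁ e₂) :
    lform e₂ e₁ = 0 := by rw [lform_comm, h.e12]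

theorem IsPerp.add {e₁ e₂ x y : Fin 2 ⊕ Fin m → ℝ} (hx : IsPerp e₁ e₂ x) (hy : IsPerp e₁ e₂ y) :
    IsPerp e₁ e₂ (x + y) :=
  ⟨by simp [hx.e1x, hy.e1x], by simp [hx.e2x, hy.e2x]⟩

theorem IsPerp.sub {e₁ e₂ x y : Fin 2 ⊕ Fin m → ℝ} (hx : IsPerp e₁ e₂ x) (hy : IsPerp e₁ e₂ y) :
    IsPerp e₁ e₂ (x - y) :=
  ⟨by simp [hx.e1x, hy.e1x], by simp [hx.e2x, hy.e2x]⟩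

theorem IsPerp.smul {e₁ e₂ x : Fin 2 ⊕ Fin m → ℝ} (c : ℝ) (hx : IsPerp e₁ e₂ x) :
    IsPerp e₁ e₂ (c • x) :=
  ⟨by simp [hx.e1x], by simp [hx.e2x]⟩

theorem isPerp_zero {e₁ e₂ : Fin 2 ⊕ Fin m → ℝ} : IsPerp e₁ e₂ 0 := ⟨by simp, by simp⟩

theorem IsFrame.eq_zero {W : Mat m} {e₁ e₂ x : Fin 2 ⊕ Fin m → ℝ} (h : IsFrame W e₁ e₂)
    (hx : IsPerp e₁ e₂ x) (h0 : lform x x = 0) : x = 0 := by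
  by_contra hne
  exact (h.pos x hx.e1x hx.e2x hne).ne' h0

theorem wedge_add_mem_lieAlg (e₁ e₂ x₁ x₂ : Fin 2 ⊕ Fin m → ℝ) :
    wedge e₁ x₁ + wedge e₂ x₂ ∈ lieAlg m :=
  (lieAlgSubmodule m).add_mem (wedge_mem_lieAlg _ _) (wedge_mem_lieAlg _ _)

/-- The complex structure sends `e₁ ∧ x₁ + e₂ ∧ x₂` to `e₁ ∧ x₂ - e₂ ∧ x₁`. -/
theorem IsFrame.lie_wedge {W : Mat m} {e₁ e₂ x₁ x₂ : Fin 2 ⊕ Fin m → ℝ} (h : IsFrame W e₁ e₂)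
    (h₁ : IsPerp e₁ e₂ x₁) (h₂ : IsPerp e₁ e₂ x₂) :
    ⁅W, wedge e₁ x₁ + wedge e₂ x₂⁆ = wedge e₁ x₂ - wedge e₂ x₁ := by
  rw [h.eq, Ring.lie_def]
  simp only [wedge, neg_sub, mul_add, add_mul, mul_sub, sub_mul, tens_mul_tens, h.e11, h.e12,
    h.e22, h.e21, h₁.e1x, h₁.e2x, h₁.xe1, h₁.xe2, h₂.e1x, h₂.e2x, h₂.xe1, h₂.xe2]
  module

theorem IsFrame.wedge_mem_tangentSet {W : Mat m} {e₁ e₂ x₁ x₂ : Fin 2 ⊕ Fin m → ℝ}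
    (h : IsFrame W e₁ e₂) (h₁ : IsPerp e₁ e₂ x₁) (h₂ : IsPerp e₁ e₂ x₂) :
    wedge e₁ x₁ + wedge e₂ x₂ ∈ tangentSet W := by
  refine ⟨⁅W, wedge e₁ x₁ + wedge e₂ x₂⁆,
    lie_mem_lieAlg h.mem_lieAlg (wedge_add_mem_lieAlg _ _ _ _), ?_⟩
  rw [h.lie_wedge h₁ h₂, h.eq, Ring.lie_def]
  simp only [wedge, neg_sub, mul_add, add_mul, mul_sub, sub_mul, tens_mul_tens, h.e11, h.e12,
    h.e22, h.e21, h₁.e1x, h₁.e2x, h₁.xe1, h₁.xe2, h₂.e1x, h₂.e2x, h₂.xe1, h₂.xe2]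
  module

theorem IsFrame.exists_wedge_of_mem {W V : Mat m} {e₁ e₂ : Fin 2 ⊕ Fin m → ℝ}
    (h : IsFrame W e₁ e₂) (hV : V ∈ tangentSet W) :
    ∃ x₁ x₂, IsPerp e₁ e₂ x₁ ∧ IsPerp e₁ e₂ x₂ ∧ V = wedge e₁ x₁ + wedge e₂ x₂ := by
  obtain ⟨X, hX, rfl⟩ := hV
  refine h.exists_wedge (lie_mem_lieAlg hX h.mem_lieAlg) ?_
  have : X * (W * W * W) - (W * W * W) * X = -(X * W - W * X) := by
    rw [h.cube]; noncomm_ring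
  rw [Ring.lie_def, ← this]
  noncomm_ring

theorem metric_wedge {e₁ e₂ x₁ x₂ y₁ y₂ : Fin 2 ⊕ Fin m → ℝ} {W : Mat m} (h : IsFrame W e₁ e₂)
    (h₁ : IsPerp e₁ e₂ x₁) (h₂ : IsPerp e₁ e₂ x₂) (k₁ : IsPerp e₁ e₂ y₁) (k₂ : IsPerp e₁ e₂ y₂) :
    metric (wedge e₁ x₁ + wedge e₂ x₂) (wedge e₁ y₁ + wedge e₂ y₂) =
      lform x₁ y₁ + lform x₂ y₂ := by
  simp only [metric, wedge, mul_add, add_mul, mul_sub, sub_mul, tens_mul_tens, trace_add,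
    trace_sub, trace_smul, trace_tens, h.e11, h.e12, smul_eq_mul,
    h.e22, h.e21, h₁.e1x, h₁.e2x, h₁.xe1, h₁.xe2, h₂.e1x, h₂.e2x, h₂.xe1, h₂.xe2,
    k₁.e1x, k₁.e2x, k₁.xe1, k₁.xe2, k₂.e1x, k₂.e2x, k₂.xe1, k₂.xe2]
  ring

theorem mem_lieAlg_of_mem_tangentSet {W V : Mat m} (hW : W ∈ lieAlg m) (hV : V ∈ tangentSet W) :
    V ∈ lieAlg m := by
  obtain ⟨X, hX, rfl⟩ := hV
  exact lie_mem_lieAlg hX hW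

/-- Minus the square of `ad W` is the projection onto the tangent space of the quadric. -/
theorem IsFrame.neg_lie_lie {W : Mat m} {e₁ e₂ a b x y : Fin 2 ⊕ Fin m → ℝ} (h : IsFrame W e₁ e₂)
    (ha : IsPerp e₁ e₂ a) (hb : IsPerp e₁ e₂ b) (hx : IsPerp e₁ e₂ x) (hy : IsPerp e₁ e₂ y)
    (c : ℝ) :
    -⁅W, ⁅W, wedge e₁ a + wedge e₂ b + wedge x y + c • wedge e₁ e₂⁆⁆ =
      wedge e₁ a + wedge e₂ b := by
  have h1 : ⁅W, wedge e₁ a + wedge e₂ b + wedge x y + c • wedge e₁ e₂⁆ =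
      ⁅W, wedge e₁ a + wedge e₂ b⁆ := by
    rw [h.eq, Ring.lie_def, Ring.lie_def]
    simp only [wedge, neg_sub, mul_add, add_mul, mul_sub, sub_mul, mul_smul_comm, smul_mul_assoc,
      tens_mul_tens, h.e11, h.e12, h.e22, h.e21, ha.e1x, ha.e2x, ha.xe1, ha.xe2, hb.e1x, hb.e2x,
      hb.xe1, hb.xe2, hx.e1x, hx.e2x, hx.xe1, hx.xe2, hy.e1x, hy.e2x, hy.xe1, hy.xe2]
    module
  have h2 : wedge e₁ b - wedge e₂ a = wedge e₁ b + wedge e₂ (-a) := by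
    simp [wedge]; abel
  rw [h1, h.lie_wedge ha hb, h2, h.lie_wedge hb (by simpa using ha.smul (-1))]
  simp [wedge]; abel

/-! ### Frames adapted to an `𝔄`-principal vector -/

/-- A frame of the point `W` adapted to an `𝔄`-principal unit vector `N = e₁ ∧ v`. -/
structure IsAdapted (W N : Mat m) (e₁ e₂ v : Fin 2 ⊕ Fin m → ℝ) : Prop where
  frame : IsFrame W e₁ e₂
  perp : IsPerp e₁ e₂ v
  unit : lform v v = 1
  eq : N = wedge e₁ v

theorem reflection_conj_wedge {e₁ e₂ x₁ x₂ : Fin 2 ⊕ Fin m → ℝ} {W : Mat m}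
    (h : IsFrame W e₁ e₂) (h₁ : IsPerp e₁ e₂ x₁) (h₂ : IsPerp e₁ e₂ x₂) :
    (1 + (2 : ℝ) • tens e₂ e₂) * (wedge e₁ x₁ + wedge e₂ x₂) * (1 + (2 : ℝ) • tens e₂ e₂)⁻¹ =
      wedge e₁ x₁ - wedge e₂ x₂ := by
  have hi : (1 + (2 : ℝ) • tens e₂ e₂)⁻¹ = 1 + (2 : ℝ) • tens e₂ e₂ := by
    refine inv_eq_left_inv ?_
    simp only [mul_add, add_mul, mul_one, one_mul, smul_mul_assoc, mul_smul_comm, tens_mul_tens,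
      h.e22]
    module
  rw [hi]
  simp only [wedge, mul_add, add_mul, mul_sub, sub_mul, mul_one, one_mul, smul_mul_assoc,
    mul_smul_comm, tens_mul_tens, smul_add, smul_sub, h.e11, h.e12,
    h.e22, h.e21, h₁.e1x, h₁.e2x, h₁.xe1, h₁.xe2, h₂.e1x, h₂.e2x, h₂.xe1, h₂.xe2]
  module

/-- The coordinates of `e₁ ∧ x₁ + e₂ ∧ x₂` are its values at `e₁` and `e₂`. -/
theorem IsFrame.wedge_inj {W : Mat m} {e₁ e₂ x₁ x₂ y₁ y₂ : Fin 2 ⊕ Fin m → ℝ}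
    (h : IsFrame W e₁ e₂)
    (h₁ : IsPerp e₁ e₂ x₁) (h₂ : IsPerp e₁ e₂ x₂) (k₁ : IsPerp e₁ e₂ y₁) (k₂ : IsPerp e₁ e₂ y₂)
    (e : wedge e₁ x₁ + wedge e₂ x₂ = wedge e₁ y₁ + wedge e₂ y₂) : x₁ = y₁ ∧ x₂ = y₂ := by
  constructor
  · have := congrArg (fun A => A *ᵥ e₁) e
    simp only [wedge, add_mulVec, sub_mulVec, tens_mulVec, h.e11, h.e12, h.e21, h₁.xe1, h₂.xe1,
      k₁.xe1, k₂.xe1] at this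
    simpa using this
  · have := congrArg (fun A => A *ᵥ e₂) e
    simp only [wedge, add_mulVec, sub_mulVec, tens_mulVec, h.e22, h.e12, h.e21, h₁.xe2, h₂.xe2,
      k₁.xe2, k₂.xe2] at this
    simpa using this

theorem IsPrincipal.exists_isAdapted {W N : Mat m} (hN : IsPrincipal W N) (h1 : metric N N = 1) :
    ∃ e₁ e₂ v, IsAdapted W N e₁ e₂ v := by
  obtain ⟨hT, -, A, ⟨h, hh, rfl, θ, hA⟩, hAN⟩ := hN
  have hs := transvections_spec hh
  have hf := conj_isFrame hs
  set e₁ := h *ᵥ stdNeg m 0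
  set e₂ := h *ᵥ stdNeg m 1
  set W := h * base m * h⁻¹
  obtain ⟨x₁, x₂, h₁, h₂, rfl⟩ := hf.exists_wedge_of_mem hT
  have hu : IsUnit h.det := by
    have := congrArg det hs
    rw [det_mul, det_mul, det_transpose] at this
    have h2 : (signature m).det ≠ 0 := by
      intro h0
      have := congrArg det (signature_mul_self (m := m))
      simp [h0] at this
    rw [isUnit_iff_ne_zero]
    rintro h0
    simp [h0] at this
    exact h2 this.symm
  have hR : h * reflection m * h⁻¹ = 1 + (2 : ℝ) • tens e₂ e₂ := by
    rw [reflection_eq, mul_add, add_mul, mul_one, mul_nonsing_inv _ hu, mul_smul_comm,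
      smul_mul_assoc, conj_tens hs]
  rw [hA, hR, reflection_conj_wedge hf h₁ h₂, J] at hAN
  have hJ : ⁅W, wedge e₁ x₁ - wedge e₂ x₂⁆ = -wedge e₁ x₂ - wedge e₂ x₁ := by
    have := hf.lie_wedge h₁ (h₂.smul (-1))
    simp only [wedge, tens_smul_left, tens_smul_right] at this ⊢
    convert this using 1
    · congr 1; module
    · module
  rw [hJ] at hAN
  have hAN' : wedge e₁ (Real.cos θ • x₁ - Real.sin θ • x₂) +
      wedge e₂ (-(Real.cos θ • x₂) - Real.sin θ • x₁) = wedge e₁ x₁ + wedge e₂ x₂ := by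
    rw [← hAN]
    simp only [wedge, tens_smul_left, tens_smul_right, tens_sub_left, tens_sub_right,
      tens_neg_left, tens_neg_right]
    module
  obtain ⟨i1, i2⟩ := hf.wedge_inj ((h₁.smul _).sub (h₂.smul _))
    (by simpa using ((h₂.smul (-Real.cos θ)).sub (h₁.smul (Real.sin θ)))) h₁ h₂ hAN'
  -- The half angle rotates the frame into one for which the second component vanishes.
  obtain ⟨φ, rfl⟩ : ∃ φ, θ = 2 * φ := ⟨θ / 2, by ring⟩
  set c := Real.cos φ
  set s := Real.sin φ
  have hcs : s ^ 2 + c ^ 2 = 1 := Real.sin_sq_add_cos_sq φ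
  have hc : Real.cos (2 * φ) = c ^ 2 - s ^ 2 := Real.cos_two_mul' φ
  have hsn : Real.sin (2 * φ) = 2 * s * c := Real.sin_two_mul φ
  rw [hc, hsn] at i1 i2
  have j1 : x₁ = c • (c • x₁ - s • x₂) := by
    have : (1/2 : ℝ) • ((c ^ 2 - s ^ 2) • x₁ - (2 * s * c) • x₂) +
        (1/2 : ℝ) • ((s^2+c^2) • x₁) = x₁ := by
      rw [i1, hcs]; module
    nth_rewrite 1 [← this]
    module
  have j2 : x₂ = -s • (c • x₁ - s • x₂) := by
    have : (1/2 : ℝ) • (-((c ^ 2 - s ^ 2) • x₂) - (2 * s * c) • x₁) +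
        (1/2 : ℝ) • ((s^2+c^2) • x₂) = x₂ := by
      rw [i2, hcs]; module
    nth_rewrite 1 [← this]
    module
  have hv : IsPerp e₁ e₂ (c • x₁ - s • x₂) := (h₁.smul _).sub (h₂.smul _)
  set v := c • x₁ - s • x₂
  have hvu : lform v v = 1 := by
    rw [metric_wedge hf h₁ h₂ h₁ h₂, j1, j2] at h1
    simp only [lform_smul_left, lform_smul_right] at h1
    linear_combination h1 - lform v v * hcs
  refine ⟨c • e₁ - s • e₂, s • e₁ + c • e₂, v, ⟨?_, ?_, ?_, ?_, ?_⟩, ⟨?_, ?_⟩, hvu, ?_⟩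
  · rw [hf.eq]
    simp only [wedge, tens_smul_left, tens_smul_right, tens_sub_left, tens_sub_right,
      tens_add_left, tens_add_right]
    have : (tens e₁ e₂ - tens e₂ e₁) = (s^2+c^2) • (tens e₁ e₂ - tens e₂ e₁) := by
      rw [hcs, one_smul]
    rw [this]
    module
  · simp [hf.e11, hf.e12, hf.e21, hf.e22]; linear_combination -hcs
  · simp [hf.e11, hf.e12, hf.e21, hf.e22]; linear_combination -hcs
  · simp [hf.e11, hf.e12, hf.e21, hf.e22]; ring
  · intro x hx1 hx2 hx0
    simp only [lform_sub_left, lform_add_left, lform_smul_left] at hx1 hx2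
    refine hf.pos x ?_ ?_ hx0
    · linear_combination c * hx1 + s * hx2 - lform e₁ x * hcs
    · linear_combination c * hx2 - s * hx1 - lform e₂ x * hcs
  · simp [hv.e1x, hv.e2x]
  · simp [hv.e1x, hv.e2x]
  · rw [j1, j2]
    simp only [wedge, tens_smul_left, tens_smul_right, tens_sub_left, tens_sub_right]
    module

theorem exists_isPerp {m : ℕ} (hm : 2 ≤ m) (e₁ e₂ v : Fin 2 ⊕ Fin m → ℝ) :
    ∃ x, x ≠ 0 ∧ IsPerp e₁ e₂ x ∧ lform v x = 0 := by
  let Φ : (Fin 2 ⊕ Fin m → ℝ) →ₗ[ℝ] (Fin 3 → ℝ) :=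
    { toFun := fun x => ![lform e₁ x, lform e₂ x, lform v x]
      map_add' := by intro x y; ext i; fin_cases i <;> simp
      map_smul' := by intro c x; ext i; fin_cases i <;> simp }
  have : Φ.ker ≠ ⊥ := by
    apply LinearMap.ker_ne_bot_of_finrank_lt
    simp; omega
  obtain ⟨x, hx, hx0⟩ := Submodule.exists_mem_ne_zero_of_ne_bot this
  have hx' : ![lform e₁ x, lform e₂ x, lform v x] = 0 := hx
  exact ⟨x, hx0, ⟨by simpa using congrFun hx' 0, by simpa using congrFun hx' 1⟩,
    by simpa using congrFun hx' 2⟩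

theorem IsAdapted.mul_self {W N : Mat m} {e₁ e₂ v : Fin 2 ⊕ Fin m → ℝ}
    (hF : IsAdapted W N e₁ e₂ v) : N * N = tens v v - tens e₁ e₁ := by
  rw [hF.eq]
  simp only [wedge, mul_sub, sub_mul, tens_mul_tens, hF.frame.e11, hF.unit, hF.perp.e1x,
    hF.perp.xe1]
  module

/-- In an adapted frame, the orthogonal projection `P` onto the line of `e₁`, expressed through `W`
and `N`. For a tangent vector `V` of the quadric, `P V + V P` is the component of `V` fixed by
the real structure that fixes `N`. -/
noncomputable def proj (W N : Mat m) : Mat m := -(W * W * (N * N))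

theorem IsAdapted.proj_eq {W N : Mat m} {e₁ e₂ v : Fin 2 ⊕ Fin m → ℝ}
    (hF : IsAdapted W N e₁ e₂ v) : proj W N = -tens e₁ e₁ := by
  rw [proj, hF.mul_self, hF.frame.mul_self]
  simp only [mul_sub, add_mul, tens_mul_tens, hF.frame.e11, hF.frame.e21, hF.perp.e1x,
    hF.perp.e2x]
  module

theorem IsAdapted.lie_eq {W N : Mat m} {e₁ e₂ v : Fin 2 ⊕ Fin m → ℝ}
    (hF : IsAdapted W N e₁ e₂ v) : W * N - N * W = -wedge e₂ v := by
  have := hF.frame.lie_wedge hF.perp isPerp_zero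
  rw [Ring.lie_def, show wedge e₁ v + wedge e₂ 0 = N by rw [hF.eq]; simp [wedge]] at this
  rw [this]
  simp [wedge]

theorem IsAdapted.lie_lie {W N : Mat m} {e₁ e₂ v : Fin 2 ⊕ Fin m → ℝ}
    (hF : IsAdapted W N e₁ e₂ v) : W * (W * N - N * W) - (W * N - N * W) * W = -N := by
  have := hF.frame.lie_wedge isPerp_zero (hF.perp.smul (-1))
  rw [Ring.lie_def, show wedge e₁ 0 + wedge e₂ ((-1 : ℝ) • v) = W * N - N * W by
    rw [hF.lie_eq]; simp [wedge]; abel] at this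
  rw [this, hF.eq]
  simp [wedge]; abel

theorem IsAdapted.sandwich {W N : Mat m} {e₁ e₂ v : Fin 2 ⊕ Fin m → ℝ}
    (hF : IsAdapted W N e₁ e₂ v) : N * W * N = 0 := by
  rw [hF.eq, hF.frame.eq]
  simp only [wedge, neg_sub, mul_sub, sub_mul, tens_mul_tens, hF.frame.e11, hF.frame.e12,
    hF.frame.e21, hF.unit, hF.perp.e1x, hF.perp.xe1, hF.perp.e2x, hF.perp.xe2, smul_mul_assoc]
  module

theorem IsAdapted.reeb_eq {M : Type*} {f N : M → Mat m} {q : M}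
    {e₁ e₂ v : Fin 2 ⊕ Fin m → ℝ}
    (hF : IsAdapted (f q) (N q) e₁ e₂ v) : reeb f N q = wedge e₂ v := by
  rw [reeb, J, Ring.lie_def, hF.lie_eq, neg_neg]

/-- In an adapted frame, the orthogonal projection onto the orthogonal complement of
`e₁`, `e₂`, `v`, expressed through `W` and `N`. -/
noncomputable def complProj (W N : Mat m) : Mat m := (1 + W * W) * (1 - N * N)

/-- In an adapted frame, the orthogonal projection onto the line of `e₂`, expressed through `W`
and `N`. -/
noncomputable def lineProj (W N : Mat m) : Mat m := -(W * (N * N) * W)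

theorem IsAdapted.complProj_eq {W N : Mat m} {e₁ e₂ v : Fin 2 ⊕ Fin m → ℝ}
    (hF : IsAdapted W N e₁ e₂ v) :
    complProj W N = 1 + tens e₁ e₁ + tens e₂ e₂ - tens v v := by
  rw [complProj, hF.mul_self, hF.frame.mul_self]
  simp only [mul_sub, add_mul, mul_add, one_mul, mul_one, tens_mul_tens, hF.frame.e11,
    hF.frame.e21, hF.perp.e1x, hF.perp.e2x]
  module

theorem IsAdapted.lineProj_eq {W N : Mat m} {e₁ e₂ v : Fin 2 ⊕ Fin m → ℝ}
    (hF : IsAdapted W N e₁ e₂ v) : lineProj W N = -tens e₂ e₂ := by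
  rw [lineProj, hF.mul_self, hF.frame.eq]
  simp only [wedge, neg_sub, mul_sub, sub_mul, tens_mul_tens, hF.frame.e11, hF.frame.e12,
    hF.frame.e21, hF.perp.e1x, hF.perp.xe1, hF.perp.e2x, hF.perp.xe2, smul_mul_assoc]
  module

end Algebra

/-! ### Directional derivatives on a manifold -/

section Calculus

variable {n : ℕ} {M : Type*} [TopologicalSpace M] [ChartedSpace (EuclideanSpace ℝ (Fin n)) M]
  {F : Type*} [NormedAddCommGroup F] [NormedSpace ℝ F]
  {R : Type*} [NormedRing R] [NormedAlgebra ℝ R]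

/-- `Y` is differentiable at `q`, with derivative `D` in the direction of the tangent vector
`y`. -/
structure HasDerAlong (Y : M → F) (q : M) (y : TangentSpace (𝓡 n) q) (D : F) : Prop where
  diff : MDifferentiableAt (𝓡 n) 𝓘(ℝ, F) Y q
  val : mvfderiv (𝓡 n) Y q y = D

namespace HasDerAlong

variable {q : M} {y : TangentSpace (𝓡 n) q}

theorem of_diff {Y : M → F} (h : MDifferentiableAt (𝓡 n) 𝓘(ℝ, F) Y q) :
    HasDerAlong Y q y (mvfderiv (𝓡 n) Y q y) := ⟨h, rfl⟩

theorem unique {Y : M → F} {D D' : F} (h : HasDerAlong Y q y D) (h' : HasDerAlong Y q y D') :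
    D = D' := h.val.symm.trans h'.val

theorem congr {Y Z : M → F} {D : F} (h : HasDerAlong Y q y D) (e : Z =ᶠ[𝓝 q] Y) :
    HasDerAlong Z q y D :=
  ⟨h.diff.congr_of_eventuallyEq e, by
    rw [← h.val]; unfold mvfderiv; rw [e.mfderiv_eq]
    have := e.self_of_nhds
    simp only [NormedSpace.fromTangentSpace]
    rfl⟩

theorem const (c : F) : HasDerAlong (fun _ : M => c) q y 0 :=
  ⟨mdifferentiableAt_const, by rw [mvfderiv_const]; rfl⟩

theorem add {Y Z : M → F} {D E : F} (h : HasDerAlong Y q y D) (k : HasDerAlong Z q y E) :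
    HasDerAlong (fun p => Y p + Z p) q y (D + E) :=
  ⟨h.diff.add k.diff, by rw [mvfderiv_fun_add h.diff k.diff, ← h.val, ← k.val]; rfl⟩

theorem sub {Y Z : M → F} {D E : F} (h : HasDerAlong Y q y D) (k : HasDerAlong Z q y E) :
    HasDerAlong (fun p => Y p - Z p) q y (D - E) :=
  ⟨h.diff.sub k.diff, by rw [mvfderiv_fun_sub h.diff k.diff, ← h.val, ← k.val]; rfl⟩

theorem neg {Y : M → F} {D : F} (h : HasDerAlong Y q y D) :
    HasDerAlong (fun p => -Y p) q y (-D) :=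
  ⟨h.diff.neg, by rw [mvfderiv_fun_neg, ← h.val]; rfl⟩

theorem smul {a : M → ℝ} {Y : M → F} {d : ℝ} {D : F} (ha : HasDerAlong a q y d)
    (h : HasDerAlong Y q y D) :
    HasDerAlong (fun p => a p • Y p) q y (a q • D + d • Y q) :=
  ⟨ha.diff.smul h.diff, by rw [mvfderiv_fun_smul ha.diff h.diff, ← h.val, ← ha.val]; rfl⟩

theorem mul {Y Z : M → R} {D E : R} (h : HasDerAlong Y q y D) (k : HasDerAlong Z q y E) :
    HasDerAlong (fun p => Y p * Z p) q y (Y q * E + D * Z q) := by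
  have := (h.diff.hasMFDerivAt).mul' (k.diff.hasMFDerivAt)
  refine ⟨this.mdifferentiableAt, ?_⟩
  rw [← h.val, ← k.val]
  unfold mvfderiv
  have e := this.mfderiv
  change NormedSpace.fromTangentSpace _ (mfderiv (𝓡 n) 𝓘(ℝ, R) (Y * Z) q y) = _
  rw [e]
  rfl

theorem clm {G : Type*} [NormedAddCommGroup G] [NormedSpace ℝ G] {Y : M → F} {D : F}
    (h : HasDerAlong Y q y D) (L : F →L[ℝ] G) :
    HasDerAlong (fun p => L (Y p)) q y (L D) := by
  have := (L.hasMFDerivAt (x := Y q)).comp q h.diff.hasMFDerivAt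
  refine ⟨this.mdifferentiableAt, ?_⟩
  rw [← h.val]
  unfold mvfderiv
  have e := this.mfderiv
  change NormedSpace.fromTangentSpace _ (mfderiv (𝓡 n) 𝓘(ℝ, G) (L ∘ Y) q y) = _
  rw [e]
  rfl

end HasDerAlong

/-- Every tangent vector extends to a vector field, in such a way that the extensions commute:
in a chart, they are the constant vector fields. -/
theorem exists_commuting_extension [IsManifold (𝓡 n) ∞ M] (q : M) :
    ∃ ext : TangentSpace (𝓡 n) q → (∀ p : M, TangentSpace (𝓡 n) p), (∀ x, ext x q = x) ∧
      ∀ A : M → F, ContMDiffAt (𝓡 n) 𝓘(ℝ, F) ∞ A q →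
        ∀ x y, ∃ D, HasDerAlong (fun p => mvfderiv (𝓡 n) A p (ext x p)) q y D ∧
          HasDerAlong (fun p => mvfderiv (𝓡 n) A p (ext y p)) q x D := by
  set φ := extChartAt (𝓡 n) q with hφ
  refine ⟨fun x p => mfderiv 𝓘(ℝ, EuclideanSpace ℝ (Fin n)) (𝓡 n) φ.symm (φ p) x, ?_, ?_⟩
  · intro x
    have h := mfderivWithin_range_extChartAt_symm (I := 𝓡 n) (x := q)
    rw [(𝓡 n).range_eq_univ, mfderivWithin_univ] at h
    change mfderiv 𝓘(ℝ, EuclideanSpace ℝ (Fin n)) (𝓡 n) φ.symm (φ q) x = x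
    rw [hφ, h]
    rfl
  · intro A hA
    have hsymm : ∀ p ∈ φ.source,
        ContMDiffAt 𝓘(ℝ, EuclideanSpace ℝ (Fin n)) (𝓡 n) ∞ φ.symm (φ p) := by
      intro p hp
      have := contMDiffWithinAt_extChartAt_symm_range (I := 𝓡 n) (n := ∞) q (φ.map_source hp)
      rwa [(𝓡 n).range_eq_univ, contMDiffWithinAt_univ] at this
    have hq : q ∈ φ.source := mem_extChartAt_source q
    have hA' : ContDiffAt ℝ ∞ (A ∘ φ.symm) (φ q) := by
      rw [← contMDiffAt_iff_contDiffAt]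
      exact ContMDiffAt.comp_of_eq (hg := hA) (hf := hsymm q hq) (φ.left_inv hq)
    have hdd : DifferentiableAt ℝ (fderiv ℝ (A ∘ φ.symm)) (φ q) :=
      (hA'.fderiv_right (m := 1) (by norm_cast)).differentiableAt (by norm_num)
    have hev : ∀ᶠ p in 𝓝 q, p ∈ φ.source ∧ MDifferentiableAt (𝓡 n) 𝓘(ℝ, F) A p := by
      refine Filter.Eventually.and (extChartAt_source_mem_nhds q) ?_
      filter_upwards [(contMDiffAt_iff_contMDiffAt_nhds (n := 1) (by simp)).mp
        (hA.of_le (by norm_cast))] with p hp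
      exact hp.mdifferentiableAt (by norm_num)
    have main : ∀ x y, HasDerAlong (fun p => mvfderiv (𝓡 n) A p
        (mfderiv 𝓘(ℝ, EuclideanSpace ℝ (Fin n)) (𝓡 n) φ.symm (φ p) x)) q y
        (fderiv ℝ (fderiv ℝ (A ∘ φ.symm)) (φ q) y x) := by
      intro x y
      have h1 : HasDerAlong (fun p => fderiv ℝ (A ∘ φ.symm) (φ p) x) q y
          (fderiv ℝ (fderiv ℝ (A ∘ φ.symm)) (φ q) y x) := by
        have h2 : HasFDerivAt (fun e => fderiv ℝ (A ∘ φ.symm) e x)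
            ((fderiv ℝ (fderiv ℝ (A ∘ φ.symm)) (φ q)).flip x) (φ q) := by
          have := hdd.hasFDerivAt.clm_apply (hasFDerivAt_const x (φ q))
          simpa using this
        have hφd : HasMFDerivAt (𝓡 n) 𝓘(ℝ, EuclideanSpace ℝ (Fin n)) φ q
            (ContinuousLinearMap.id ℝ _) := by
          have := (mdifferentiableAt_extChartAt (I := 𝓡 n)
            (mem_chart_source (EuclideanSpace ℝ (Fin n)) q)).hasMFDerivAt
          rwa [mfderiv_extChartAt_self] at this
        have h3 := HasMFDerivAt.comp q h2.hasMFDerivAt hφd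
        refine ⟨h3.mdifferentiableAt, ?_⟩
        unfold mvfderiv
        have e := h3.mfderiv
        change NormedSpace.fromTangentSpace _ (mfderiv (𝓡 n) 𝓘(ℝ, F)
          ((fun e => fderiv ℝ (A ∘ φ.symm) e x) ∘ φ) q y) = _
        rw [e]
        rfl
      refine h1.congr ?_
      filter_upwards [hev] with p hp
      obtain ⟨hp, hAp⟩ := hp
      have hs := (hsymm p hp).mdifferentiableAt (by norm_num)
      have hl : φ.symm (φ p) = p := φ.left_inv hp
      have := mfderiv_comp_apply_of_eq (I := 𝓘(ℝ, EuclideanSpace ℝ (Fin n))) (I' := 𝓡 n)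
        (I'' := 𝓘(ℝ, F)) (g := A) (f := φ.symm) (φ p) hAp hs hl x
      rw [mfderiv_eq_fderiv] at this
      exact this.symm
    intro x y
    refine ⟨_, main x y, ?_⟩
    have := main y x
    rwa [(hA'.isSymmSndFDerivAt (by simp; norm_cast)).eq x y] at this

end Calculus

section Hypersurface

variable {m : ℕ} {M : Type*} [TopologicalSpace M]
  [ChartedSpace (EuclideanSpace ℝ (Fin (2 * m - 1))) M]

/-! ### Hypersurfaces with `𝔄`-principal normal: tangent spaces and the Weingarten formula -/

/-- On the open set `U`, the hypersurface is Hopf, with non-vanishing Reeb curvature and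
`𝔄`-principal unit normal `N`. -/
structure IsHopfPrincipalOn (f N : M → Mat m) (U : Set M) : Prop where
  hypersurface : IsRealHypersurface f
  isOpen : IsOpen U
  normal : IsUnitNormalOn f N U
  hopf : ∀ q ∈ U, IsHopfAt f N q
  reeb_ne : ∀ q ∈ U, reebCurvature f N q ≠ 0
  principal : ∀ q ∈ U, IsPrincipal (f q) (N q)

theorem flatDeriv_eq {f : M → Mat m} (hf : IsRealHypersurface f) {X : M → Mat m} {q : M}
    {y : TangentSpace (𝓡 (2 * m - 1)) q} (hy : mvfderiv (𝓡 (2 * m - 1)) f q y = X q)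
    (Y : M → Mat m) : flatDeriv f X Y q = mvfderiv (𝓡 (2 * m - 1)) Y q y := by
  unfold flatDeriv
  rw [← hy, Function.leftInverse_invFun (hf.immersion q) y]

theorem HasDerAlong.mem_lieAlg {n : ℕ} {M : Type*} [TopologicalSpace M]
    [ChartedSpace (EuclideanSpace ℝ (Fin n)) M] {Y : M → Mat m} {q : M}
    {y : TangentSpace (𝓡 n) q} {D : Mat m} (h : HasDerAlong Y q y D)
    (hY : ∀ᶠ p in 𝓝 q, Y p ∈ lieAlg m) : D ∈ lieAlg m := by
  let L : Mat m →ₗ[ℝ] Mat m :=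
    { toFun := fun X => Xᵀ * signature m + signature m * X
      map_add' := fun a b => by rw [transpose_add]; noncomm_ring
      map_smul' := fun c a => by simp [transpose_smul] }
  have h0 := (h.clm L.toContinuousLinearMap).unique ((HasDerAlong.const (0 : Mat m)).congr (by
    filter_upwards [hY] with p hp
    have : (Y p)ᵀ * signature m = -(signature m * Y p) := hp
    change (Y p)ᵀ * signature m + signature m * Y p = 0
    rw [this, neg_add_cancel]))
  exact eq_neg_of_add_eq_zero_left h0

/-- The trace of a matrix, as a continuous linear map. -/
noncomputable def traceL (m : ℕ) : Mat m →L[ℝ] ℝ :=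
  (Matrix.traceLinearMap (Fin 2 ⊕ Fin m) ℝ ℝ).toContinuousLinearMap

@[simp] theorem traceL_apply (A : Mat m) : traceL m A = A.trace := rfl

/-- The orthogonal complement of `N` in the tangent space of the quadric has dimension at most
`2 m - 1`. -/
theorem IsAdapted.finrank_bound {W N : Mat m} {e₁ e₂ v : Fin 2 ⊕ Fin m → ℝ}
    (hF : IsAdapted W N e₁ e₂ v) :
    ∃ T : Submodule ℝ (Mat m), Module.finrank ℝ T ≤ 2 * m - 1 ∧
      ∀ V, V ∈ T ↔ ∃ x₁ x₂, IsPerp e₁ e₂ x₁ ∧ IsPerp e₁ e₂ x₂ ∧ lform x₁ v = 0 ∧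
        V = wedge e₁ x₁ + wedge e₂ x₂ := by
  let Φ : (Fin 2 ⊕ Fin m → ℝ) →ₗ[ℝ] (Fin 2 → ℝ) :=
    { toFun := fun x => ![lform e₁ x, lform e₂ x]
      map_add' := by intro x y; ext i; fin_cases i <;> simp
      map_smul' := by intro c x; ext i; fin_cases i <;> simp }
  let Ψ : (Fin 2 ⊕ Fin m → ℝ) →ₗ[ℝ] (Fin 3 → ℝ) :=
    { toFun := fun x => ![lform e₁ x, lform e₂ x, lform x v]
      map_add' := by intro x y; ext i; fin_cases i <;> simp
      map_smul' := by intro c x; ext i; fin_cases i <;> simp }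
  have hΦ : Function.Surjective Φ := by
    intro a
    refine ⟨-a 0 • e₁ - a 1 • e₂, ?_⟩
    ext i
    fin_cases i <;> simp [Φ, hF.frame.e11, hF.frame.e12, hF.frame.e21, hF.frame.e22]
  have hΨ : Function.Surjective Ψ := by
    intro a
    refine ⟨-a 0 • e₁ - a 1 • e₂ + a 2 • v, ?_⟩
    ext i
    fin_cases i <;> simp [Ψ, hF.frame.e11, hF.frame.e12, hF.frame.e21, hF.frame.e22,
      hF.perp.e1x, hF.perp.e2x, hF.unit]
  have kΦ : Module.finrank ℝ Φ.ker = m := by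
    have := LinearMap.finrank_range_add_finrank_ker Φ
    rw [LinearMap.range_eq_top.mpr hΦ] at this
    simp at this
    omega
  have kΨ : Module.finrank ℝ Ψ.ker + 1 = m := by
    have := LinearMap.finrank_range_add_finrank_ker Ψ
    rw [LinearMap.range_eq_top.mpr hΨ] at this
    simp at this
    omega
  have mΦ : ∀ x, x ∈ Φ.ker ↔ IsPerp e₁ e₂ x := by
    intro x
    rw [LinearMap.mem_ker]
    change ![lform e₁ x, lform e₂ x] = 0 ↔ _
    constructor
    · intro h
      exact ⟨by simpa using congrFun h 0, by simpa using congrFun h 1⟩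
    · intro h
      simp [h.e1x, h.e2x]
  have mΨ : ∀ x, x ∈ Ψ.ker ↔ IsPerp e₁ e₂ x ∧ lform x v = 0 := by
    intro x
    rw [LinearMap.mem_ker]
    change ![lform e₁ x, lform e₂ x, lform x v] = 0 ↔ _
    constructor
    · intro h
      exact ⟨⟨by simpa using congrFun h 0, by simpa using congrFun h 1⟩,
        by simpa using congrFun h 2⟩
    · rintro ⟨h, h'⟩
      simp [h.e1x, h.e2x, h']
  let A : (Ψ.ker × Φ.ker) →ₗ[ℝ] Mat m :=
    { toFun := fun z => wedge e₁ (z.1 : Fin 2 ⊕ Fin m → ℝ) + wedge e₂ (z.2 : Fin 2 ⊕ Fin m → ℝ)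
      map_add' := by intro a b; simp [wedge]; abel
      map_smul' := by intro c a; simp [wedge]; module }
  refine ⟨A.range, ?_, ?_⟩
  · have := LinearMap.finrank_range_le A
    rw [Module.finrank_prod] at this
    omega
  · intro V
    rw [LinearMap.mem_range]
    constructor
    · rintro ⟨⟨x₁, x₂⟩, rfl⟩
      exact ⟨x₁, x₂, ((mΨ _).1 x₁.2).1, (mΦ _).1 x₂.2, ((mΨ _).1 x₁.2).2, rfl⟩
    · rintro ⟨x₁, x₂, h₁, h₂, h₃, rfl⟩
      exact ⟨⟨⟨x₁, (mΨ _).2 ⟨h₁, h₃⟩⟩, ⟨x₂, (mΦ _).2 h₂⟩⟩, rfl⟩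

namespace IsHopfPrincipalOn

variable {f N : M → Mat m} {U : Set M} (H : IsHopfPrincipalOn f N U)
  {q : M} (hq : q ∈ U) {e₁ e₂ v : Fin 2 ⊕ Fin m → ℝ}
include H hq

theorem exists_isAdapted : ∃ e₁ e₂ v, IsAdapted (f q) (N q) e₁ e₂ v :=
  (H.principal q hq).exists_isAdapted (H.normal.unit q hq)

theorem eventually_mem : ∀ᶠ p in 𝓝 q, p ∈ U := H.isOpen.mem_nhds hq

omit hq in
theorem frame_lieAlg (q : M) : f q ∈ lieAlg m := by
  obtain ⟨_, _, h⟩ := exists_isFrame (H.hypersurface.mem_quadric q)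
  exact h.mem_lieAlg

omit hq in
theorem hasDer_f (q : M) (y : TangentSpace (𝓡 (2 * m - 1)) q) :
    HasDerAlong f q y (mvfderiv (𝓡 (2 * m - 1)) f q y) :=
  .of_diff ((H.hypersurface.smooth q).mdifferentiableAt (by norm_num))

theorem smooth_N : ContMDiffAt (𝓡 (2 * m - 1)) 𝓘(ℝ, Mat m) ∞ N q :=
  H.normal.smooth.contMDiffAt (H.eventually_mem hq)

theorem hasDer_N (y : TangentSpace (𝓡 (2 * m - 1)) q) :
    HasDerAlong N q y (mvfderiv (𝓡 (2 * m - 1)) N q y) :=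
  .of_diff ((H.smooth_N hq).mdifferentiableAt (by norm_num))

theorem exists_wedge_df (hF : IsAdapted (f q) (N q) e₁ e₂ v)
    (y : TangentSpace (𝓡 (2 * m - 1)) q) :
    ∃ x₁ x₂, IsPerp e₁ e₂ x₁ ∧ IsPerp e₁ e₂ x₂ ∧ lform x₁ v = 0 ∧
      mvfderiv (𝓡 (2 * m - 1)) f q y = wedge e₁ x₁ + wedge e₂ x₂ := by
  have hd := H.hasDer_f q y
  have hl := hd.mem_lieAlg (Filter.Eventually.of_forall H.frame_lieAlg)
  have hc := ((hd.mul hd).mul hd).unique (hd.neg.congr (Filter.Eventually.of_forall fun p => by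
    obtain ⟨_, _, h⟩ := exists_isFrame (H.hypersurface.mem_quadric p)
    exact h.cube))
  obtain ⟨x₁, x₂, h₁, h₂, e⟩ := hF.frame.exists_wedge hl (by rw [← hc]; noncomm_ring)
  refine ⟨x₁, x₂, h₁, h₂, ?_, e⟩
  have h0 := H.normal.normal q hq _ ⟨y, rfl⟩
  have hN : N q = wedge e₁ v + wedge e₂ 0 := by rw [hF.eq]; simp [wedge]
  rw [e, hN, metric_wedge hF.frame h₁ h₂ hF.perp isPerp_zero] at h0
  simpa using h0

/-- The tangent space of the hypersurface is the whole orthogonal complement of the normal, as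
the dimensions agree. -/
theorem exists_df_eq (hF : IsAdapted (f q) (N q) e₁ e₂ v) {x₁ x₂ : Fin 2 ⊕ Fin m → ℝ}
    (h₁ : IsPerp e₁ e₂ x₁) (h₂ : IsPerp e₁ e₂ x₂) (h : lform x₁ v = 0) :
    ∃ y, mvfderiv (𝓡 (2 * m - 1)) f q y = wedge e₁ x₁ + wedge e₂ x₂ := by
  obtain ⟨T, hT, mT⟩ := hF.finrank_bound
  have hle : (mvfderiv (𝓡 (2 * m - 1)) f q).toLinearMap.range ≤ T := by
    rintro _ ⟨y, rfl⟩
    exact (mT _).2 (H.exists_wedge_df hq hF y)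
  have hr : Module.finrank ℝ (mvfderiv (𝓡 (2 * m - 1)) f q).toLinearMap.range = 2 * m - 1 := by
    rw [LinearMap.finrank_range_of_inj (H.hypersurface.immersion q)]
    change Module.finrank ℝ (EuclideanSpace ℝ (Fin (2 * m - 1))) = _
    simp
  have := Submodule.eq_of_le_of_finrank_le hle (by omega)
  have hmem : wedge e₁ x₁ + wedge e₂ x₂ ∈ T := (mT _).2 ⟨x₁, x₂, h₁, h₂, h, rfl⟩
  rw [← this] at hmem
  exact hmem

end IsHopfPrincipalOn

namespace IsHopfPrincipalOn

variable {f N : M → Mat m} {U : Set M} (H : IsHopfPrincipalOn f N U)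
  {q : M} (hq : q ∈ U) {e₁ e₂ v : Fin 2 ⊕ Fin m → ℝ}
include H hq

/-- The Weingarten formula: the shape operator maps the tangent vector
`e₁ ∧ x₁ + e₂ ∧ x₂` to `e₁ ∧ s + θ (e₂ ∧ v)`. That the second component is a multiple of `v` is
the derivative of `N W N = 0`, which says that the normal is `𝔄`-principal. -/
theorem exists_weingarten (hF : IsAdapted (f q) (N q) e₁ e₂ v)
    {y : TangentSpace (𝓡 (2 * m - 1)) q} {x₁ x₂ : Fin 2 ⊕ Fin m → ℝ}
    (h₁ : IsPerp e₁ e₂ x₁) (h₂ : IsPerp e₁ e₂ x₂) (hv : lform x₁ v = 0)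
    (hy : mvfderiv (𝓡 (2 * m - 1)) f q y = wedge e₁ x₁ + wedge e₂ x₂) :
    ∃ (s : Fin 2 ⊕ Fin m → ℝ) (θ : ℝ), IsPerp e₁ e₂ s ∧ lform s v = 0 ∧
      mvfderiv (𝓡 (2 * m - 1)) N q y = wedge x₂ v - wedge e₁ s - θ • wedge e₂ v ∧
      ⁅f q, ⁅f q, mvfderiv (𝓡 (2 * m - 1)) N q y⁆⁆ = wedge e₁ s + wedge e₂ (θ • v) := by
  have hf := H.hasDer_f q y
  have hN := H.hasDer_N hq y
  rw [hy] at hf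
  have hTN : ∀ p ∈ U, N p ∈ lieAlg m := by
    intro p hp
    obtain ⟨X, hX, e⟩ := H.normal.tangent p hp
    rw [e]
    exact lie_mem_lieAlg hX (H.frame_lieAlg p)
  have hDl := hN.mem_lieAlg (by filter_upwards [H.eventually_mem hq] with p hp using hTN p hp)
  set D := mvfderiv (𝓡 (2 * m - 1)) N q y
  have hST : ⁅f q, ⁅f q, D⁆⁆ ∈ tangentSet (f q) := by
    refine ⟨-⁅f q, D⁆, (lieAlgSubmodule m).neg_mem (lie_mem_lieAlg (H.frame_lieAlg q) hDl), ?_⟩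
    simp only [Ring.lie_def]
    noncomm_ring
  obtain ⟨s₁, s₂, k₁, k₂, hS⟩ := hF.frame.exists_wedge_of_mem hST
  -- The part of `D` normal to the quadric comes from the derivative of `[W, [W, N]] = -N`.
  have hD : D = wedge x₂ v - wedge e₁ s₁ - wedge e₂ s₂ := by
    have hb := (hf.mul hN).sub (hN.mul hf)
    have h := ((hf.mul hb).sub (hb.mul hf)).unique (hN.neg.congr (by
      filter_upwards [H.eventually_mem hq] with p hp
      obtain ⟨_, _, _, hFp⟩ := H.exists_isAdapted hp
      exact hFp.lie_lie))
    simp only [Ring.lie_def] at hS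
    have h' : D = -(f q * (f q * D - D * f q) - (f q * D - D * f q) * f q)
        - ((wedge e₁ x₁ + wedge e₂ x₂) * (f q * N q - N q * f q)
            - (f q * N q - N q * f q) * (wedge e₁ x₁ + wedge e₂ x₂))
        - (f q * ((wedge e₁ x₁ + wedge e₂ x₂) * N q - N q * (wedge e₁ x₁ + wedge e₂ x₂))
            - ((wedge e₁ x₁ + wedge e₂ x₂) * N q - N q * (wedge e₁ x₁ + wedge e₂ x₂)) * f q) := by
      rw [← neg_eq_iff_eq_neg] at h
      refine h.symm.trans ?_
      noncomm_ring
    rw [hS, hF.lie_eq, hF.eq, hF.frame.eq] at h'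
    rw [h']
    simp only [wedge, neg_sub, neg_add, mul_add, add_mul, mul_sub, sub_mul, tens_mul_tens,
      smul_mul_assoc, mul_smul_comm, hF.frame.e11, hF.frame.e12,
      hF.frame.e21, hF.frame.e22, hF.unit, hF.perp.e1x, hF.perp.xe1, hF.perp.e2x, hF.perp.xe2,
      h₁.e1x, h₁.e2x, h₁.xe1, h₁.xe2, h₂.e1x, h₂.e2x, h₂.xe1, h₂.xe2, hv, lform_comm v]
    module
  have hs₁ : lform s₁ v = 0 := by
    have h := ((hN.mul hN).clm (traceL m)).unique
      ((HasDerAlong.const (2 : ℝ)).congr (by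
        filter_upwards [H.eventually_mem hq] with p hp
        have := H.normal.unit p hp
        rw [metric] at this
        simp only [traceL_apply]
        linarith))
    rw [hD, hF.eq] at h
    simp only [traceL_apply, wedge, mul_sub, sub_mul, tens_mul_tens, trace_add, trace_sub,
      trace_smul, trace_tens, smul_eq_mul, hF.frame.e11, hF.frame.e12,
      hF.frame.e21, hF.frame.e22, hF.unit, hF.perp.e1x, hF.perp.xe1, hF.perp.e2x, hF.perp.xe2,
      h₂.e1x, h₂.e2x, h₂.xe1, h₂.xe2, k₁.e1x, k₁.e2x, k₁.xe1, k₁.xe2, k₂.e1x, k₂.e2x, k₂.xe1,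
      k₂.xe2, lform_comm v] at h
    linarith
  have hs₂ : s₂ = lform s₂ v • v := by
    have h := ((hN.mul hf).mul hN).unique ((HasDerAlong.const (0 : Mat m)).congr (by
        filter_upwards [H.eventually_mem hq] with p hp
        obtain ⟨_, _, _, hFp⟩ := H.exists_isAdapted hp
        exact hFp.sandwich))
    rw [hD, hF.eq, hF.frame.eq] at h
    have h' := congrArg (fun A => A *ᵥ v) h
    simp only [wedge, neg_sub, neg_add, mul_add, add_mul, mul_sub, sub_mul, tens_mul_tens,
      smul_mul_assoc, mul_smul_comm, hF.frame.e11, hF.frame.e12,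
      hF.frame.e21, hF.frame.e22, hF.unit, hF.perp.e1x, hF.perp.xe1, hF.perp.e2x, hF.perp.xe2,
      h₁.e1x, h₁.e2x, h₁.xe1, h₁.xe2, h₂.e1x, h₂.e2x, h₂.xe1, h₂.xe2, hv, lform_comm v, hs₁,
      k₁.e1x, k₁.e2x, k₁.xe1, k₁.xe2, k₂.e1x, k₂.e2x, k₂.xe1,
      k₂.xe2, add_mulVec, sub_mulVec, smul_mulVec, tens_mulVec, zero_mulVec] at h'
    rw [← sub_eq_zero, ← h']
    module
  refine ⟨s₁, lform s₂ v, k₁, hs₁, ?_, by rw [hS, ← hs₂]⟩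
  rw [hD]
  congr 1
  nth_rewrite 1 [hs₂]
  simp only [wedge, tens_smul_left, tens_smul_right, smul_sub]

/-- The derivative of the projector `P`. In particular the circle of real structures rotates
with speed `θ`. -/
theorem hasDer_proj (hF : IsAdapted (f q) (N q) e₁ e₂ v)
    {y : TangentSpace (𝓡 (2 * m - 1)) q} {x₁ x₂ s : Fin 2 ⊕ Fin m → ℝ} {θ : ℝ}
    (h₁ : IsPerp e₁ e₂ x₁) (h₂ : IsPerp e₁ e₂ x₂) (hv : lform x₁ v = 0)
    (hy : mvfderiv (𝓡 (2 * m - 1)) f q y = wedge e₁ x₁ + wedge e₂ x₂)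
    (hs : IsPerp e₁ e₂ s) (hsv : lform s v = 0)
    (hD : mvfderiv (𝓡 (2 * m - 1)) N q y = wedge x₂ v - wedge e₁ s - θ • wedge e₂ v) :
    HasDerAlong (fun p => proj (f p) (N p)) q y
      (-tens x₂ e₁ - tens e₁ x₂ + θ • (tens e₁ e₂ + tens e₂ e₁)) := by
  have hf := H.hasDer_f q y
  have hN := H.hasDer_N hq y
  rw [hy] at hf
  rw [hD] at hN
  have h := ((hf.mul hf).mul (hN.mul hN)).neg
  refine ⟨h.diff, h.val.trans ?_⟩
  rw [hF.mul_self, hF.frame.mul_self, hF.frame.eq, hF.eq]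
  simp only [wedge, neg_sub, neg_add, mul_add, add_mul, mul_sub, sub_mul, tens_mul_tens,
      smul_mul_assoc, mul_smul_comm, hF.frame.e11, hF.frame.e12,
      hF.frame.e21, hF.frame.e22, hF.unit, hF.perp.e1x, hF.perp.xe1, hF.perp.e2x, hF.perp.xe2,
      h₁.e1x, h₁.e2x, h₁.xe1, h₁.xe2, h₂.e1x, h₂.e2x, h₂.xe1, h₂.xe2, hv, lform_comm v, hsv,
      hs.e1x, hs.e2x, hs.xe1, hs.xe2, smul_add, smul_sub]
  module

end IsHopfPrincipalOn

/-! ### Symmetry of the shape operator and the Hopf condition -/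

theorem contMDiffAt_mul {A B : M → Mat m} {q : M}
    (hA : ContMDiffAt (𝓡 (2 * m - 1)) 𝓘(ℝ, Mat m) ∞ A q)
    (hB : ContMDiffAt (𝓡 (2 * m - 1)) 𝓘(ℝ, Mat m) ∞ B q) :
    ContMDiffAt (𝓡 (2 * m - 1)) 𝓘(ℝ, Mat m) ∞ (fun p => A p * B p) q :=
  (contDiff_mul (𝕜 := ℝ) (𝔸 := Mat m)).comp_contMDiffAt (hA.prodMk_space hB)

/-- In an adapted frame at `q`, the tangent vector `y` has coordinates `(x₁, x₂)`, and the shape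
operator sends it to the vector with coordinates `(s, θ v)`. -/
structure IsWeingarten (f N : M → Mat m) (q : M) (e₁ e₂ v : Fin 2 ⊕ Fin m → ℝ)
    (y : TangentSpace (𝓡 (2 * m - 1)) q) (x₁ x₂ s : Fin 2 ⊕ Fin m → ℝ) (θ : ℝ) : Prop where
  h₁ : IsPerp e₁ e₂ x₁
  h₂ : IsPerp e₁ e₂ x₂
  hv : lform x₁ v = 0
  df : mvfderiv (𝓡 (2 * m - 1)) f q y = wedge e₁ x₁ + wedge e₂ x₂
  hs : IsPerp e₁ e₂ s
  hsv : lform s v = 0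
  dN : mvfderiv (𝓡 (2 * m - 1)) N q y = wedge x₂ v - wedge e₁ s - θ • wedge e₂ v
  lie : ⁅f q, ⁅f q, mvfderiv (𝓡 (2 * m - 1)) N q y⁆⁆ = wedge e₁ s + wedge e₂ (θ • v)

namespace IsHopfPrincipalOn

variable {f N : M → Mat m} {U : Set M} (H : IsHopfPrincipalOn f N U)
  {q : M} (hq : q ∈ U) {e₁ e₂ v : Fin 2 ⊕ Fin m → ℝ}
include H hq

theorem exists_isWeingarten_of (hF : IsAdapted (f q) (N q) e₁ e₂ v)
    {y : TangentSpace (𝓡 (2 * m - 1)) q} {x₁ x₂ : Fin 2 ⊕ Fin m → ℝ}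
    (h₁ : IsPerp e₁ e₂ x₁) (h₂ : IsPerp e₁ e₂ x₂) (hv : lform x₁ v = 0)
    (hy : mvfderiv (𝓡 (2 * m - 1)) f q y = wedge e₁ x₁ + wedge e₂ x₂) :
    ∃ s θ, IsWeingarten f N q e₁ e₂ v y x₁ x₂ s θ := by
  obtain ⟨s, θ, a, b, c, d⟩ := H.exists_weingarten hq hF h₁ h₂ hv hy
  exact ⟨s, θ, h₁, h₂, hv, hy, a, b, c, d⟩

theorem exists_isWeingarten (hF : IsAdapted (f q) (N q) e₁ e₂ v)
    (y : TangentSpace (𝓡 (2 * m - 1)) q) :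
    ∃ x₁ x₂ s θ, IsWeingarten f N q e₁ e₂ v y x₁ x₂ s θ := by
  obtain ⟨x₁, x₂, h₁, h₂, hv, hy⟩ := H.exists_wedge_df hq hF y
  obtain ⟨s, θ, h⟩ := H.exists_isWeingarten_of hq hF h₁ h₂ hv hy
  exact ⟨x₁, x₂, s, θ, h⟩

theorem trace_df_mul (y : TangentSpace (𝓡 (2 * m - 1)) q) :
    (mvfderiv (𝓡 (2 * m - 1)) f q y * N q).trace = 0 := by
  have := H.normal.normal q hq _ ⟨y, rfl⟩
  rw [metric] at this
  linarith

/-- The shape operator is symmetric. -/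
theorem shape_symm [IsManifold (𝓡 (2 * m - 1)) ∞ M] (hF : IsAdapted (f q) (N q) e₁ e₂ v)
    {y y' : TangentSpace (𝓡 (2 * m - 1)) q} {x₁ x₂ s x₁' x₂' s' : Fin 2 ⊕ Fin m → ℝ} {θ θ' : ℝ}
    (h : IsWeingarten f N q e₁ e₂ v y x₁ x₂ s θ)
    (h' : IsWeingarten f N q e₁ e₂ v y' x₁' x₂' s' θ') :
    lform x₁' s + θ * lform x₂' v = lform x₁ s' + θ' * lform x₂ v := by
  obtain ⟨ext, hext, hsym⟩ := exists_commuting_extension (n := 2 * m - 1) (F := Mat m) q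
  obtain ⟨D, d, d'⟩ := hsym f (H.hypersurface.smooth q) y' y
  -- For commuting fields the second derivatives of `f` cancel in the derivatives of `⟨df, N⟩ = 0`.
  have key : ∀ z : TangentSpace (𝓡 (2 * m - 1)) q,
      (fun p => traceL m (mvfderiv (𝓡 (2 * m - 1)) f p (ext z p) * N p)) =ᶠ[𝓝 q] fun _ => 0 := by
    intro z
    filter_upwards [H.eventually_mem hq] with p hp using H.trace_df_mul hp _
  have a := ((d.mul (H.hasDer_N hq y)).clm (traceL m)).unique
    ((HasDerAlong.const (0 : ℝ)).congr (key y'))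
  have b := ((d'.mul (H.hasDer_N hq y')).clm (traceL m)).unique
    ((HasDerAlong.const (0 : ℝ)).congr (key y))
  rw [hext, h.dN, h'.df] at a
  rw [hext, h'.dN, h.df] at b
  have c := a.trans b.symm
  simp only [traceL_apply, trace_add, add_left_inj, wedge, mul_sub, sub_mul, add_mul,
      tens_mul_tens, mul_smul_comm, trace_sub,
      trace_smul, trace_tens, smul_eq_mul, hF.frame.e11, hF.frame.e12,
      hF.frame.e21, hF.frame.e22, hF.unit, hF.perp.e1x, hF.perp.xe1, hF.perp.e2x, hF.perp.xe2,
      h.h₁.e1x, h.h₁.e2x, h.h₁.xe1, h.h₁.xe2, h.h₂.e1x, h.h₂.e2x, h.h₂.xe1, h.h₂.xe2,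
      h'.h₁.e1x, h'.h₁.e2x, h'.h₁.xe1, h'.h₁.xe2, h'.h₂.e1x, h'.h₂.e2x, h'.h₂.xe1, h'.h₂.xe2,
      h.hs.e1x, h.hs.e2x, h.hs.xe1, h.hs.xe2, h'.hs.e1x, h'.hs.e2x, h'.hs.xe1, h'.hs.xe2,
      h.hv, h.hsv, h'.hv, h'.hsv, lform_comm v] at c
  linarith

/-- The Hopf condition in coordinates. -/
theorem exists_reeb (hF : IsAdapted (f q) (N q) e₁ e₂ v) :
    ∃ y, IsWeingarten f N q e₁ e₂ v y 0 v 0 (reebCurvature f N q) := by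
  obtain ⟨y, hy⟩ := H.exists_df_eq hq hF isPerp_zero hF.perp (by simp)
  obtain ⟨s, θ, h⟩ := H.exists_isWeingarten_of hq hF isPerp_zero hF.perp (by simp) hy
  refine ⟨y, ?_⟩
  have hr : mvfderiv (𝓡 (2 * m - 1)) f q y = reeb f N q := by
    rw [hy, hF.reeb_eq]; simp [wedge]
  have hh : shape f N (reeb f N) q = reebCurvature f N q • reeb f N q := H.hopf q hq
  rw [shape, ambientNabla, neg_neg, flatDeriv_eq H.hypersurface hr, h.lie] at hh
  set α := reebCurvature f N q
  rw [hF.reeb_eq] at hh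
  have hh' : wedge e₁ s + wedge e₂ (θ • v) = wedge e₁ 0 + wedge e₂ (α • v) := by
    rw [hh]; simp [wedge, smul_sub]
  obtain ⟨rfl, i⟩ := hF.frame.wedge_inj h.hs (hF.perp.smul _) isPerp_zero (hF.perp.smul _) hh'
  have : θ = α := by
    have := congrArg (lform v) i
    simpa [hF.unit] using this
  rwa [this] at h

theorem theta_eq [IsManifold (𝓡 (2 * m - 1)) ∞ M] (hF : IsAdapted (f q) (N q) e₁ e₂ v)
    {y : TangentSpace (𝓡 (2 * m - 1)) q} {x₁ x₂ s : Fin 2 ⊕ Fin m → ℝ} {θ : ℝ}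
    (h : IsWeingarten f N q e₁ e₂ v y x₁ x₂ s θ) : θ = reebCurvature f N q * lform x₂ v := by
  obtain ⟨y₀, h₀⟩ := H.exists_reeb hq hF
  have := H.shape_symm hq hF h h₀
  simpa [hF.unit] using this

theorem smooth_proj :
    ContMDiffAt (𝓡 (2 * m - 1)) 𝓘(ℝ, Mat m) ∞ (fun p => proj (f p) (N p)) q := by
  have hf := H.hypersurface.smooth q
  have hN := H.smooth_N hq
  exact contDiff_neg.comp_contMDiffAt (contMDiffAt_mul (contMDiffAt_mul hf hf)
    (contMDiffAt_mul hN hN))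

/-- The Hopf condition says that the connection form `tr (dP W P)` of the circle of real
structures is `α η`, where `η` is the form dual to the Reeb field. -/
theorem trace_dproj [IsManifold (𝓡 (2 * m - 1)) ∞ M] (y : TangentSpace (𝓡 (2 * m - 1)) q) :
    (mvfderiv (𝓡 (2 * m - 1)) (fun p => proj (f p) (N p)) q y *
      (f q * proj (f q) (N q))).trace = reebCurvature f N q *
      (mvfderiv (𝓡 (2 * m - 1)) f q y * (N q * f q - f q * N q)).trace / 2 := by
  obtain ⟨e₁, e₂, v, hF⟩ := H.exists_isAdapted hq
  obtain ⟨x₁, x₂, s, θ, h⟩ := H.exists_isWeingarten hq hF y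
  have hr : N q * f q - f q * N q = wedge e₂ v := by
    rw [← neg_sub, hF.lie_eq, neg_neg]
  have hp : f q * proj (f q) (N q) = tens e₂ e₁ := by
    rw [hF.proj_eq, hF.frame.eq]
    simp only [wedge, mul_neg, neg_mul, neg_neg, sub_mul, tens_mul_tens, hF.frame.e11,
      hF.frame.e21]
    module
  rw [hr, hp, (H.hasDer_proj hq hF h.h₁ h.h₂ h.hv h.df h.hs h.hsv h.dN).val,
    H.theta_eq hq hF h, h.df]
  generalize reebCurvature f N q = α
  simp only [traceL_apply, trace_add, add_left_inj, wedge, mul_sub, sub_mul, add_mul, neg_mul,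
      tens_neg_left, trace_neg, smul_add, smul_mul_assoc,
      tens_mul_tens, mul_smul_comm, trace_sub,
      trace_smul, trace_tens, smul_eq_mul, hF.frame.e11, hF.frame.e12,
      hF.frame.e21, hF.frame.e22, hF.unit, hF.perp.e1x, hF.perp.xe1, hF.perp.e2x, hF.perp.xe2,
      h.h₁.e1x, h.h₁.e2x, h.h₁.xe1, h.h₁.xe2, h.h₂.e1x, h.h₂.e2x, h.h₂.xe1, h.h₂.xe2]
  ring

/-- The Reeb curvature is the quotient of the connection form and `η`, evaluated on a field with
value `ξ` at `q`. -/
theorem mdifferentiableAt_reebCurvature [IsManifold (𝓡 (2 * m - 1)) ∞ M] :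
    MDifferentiableAt (𝓡 (2 * m - 1)) 𝓘(ℝ, ℝ) (reebCurvature f N) q := by
  obtain ⟨e₁, e₂, v, hF⟩ := H.exists_isAdapted hq
  obtain ⟨y, hy⟩ := H.exists_reeb hq hF
  obtain ⟨ext, hext, hsym⟩ := exists_commuting_extension (n := 2 * m - 1) (F := Mat m) q
  obtain ⟨_, d, -⟩ := hsym f (H.hypersurface.smooth q) y y
  obtain ⟨_, d', -⟩ := hsym _ (H.smooth_proj hq) y y
  have hf := H.hasDer_f q y
  have hN := H.hasDer_N hq y
  have hP := HasDerAlong.of_diff (y := y) ((H.smooth_proj hq).mdifferentiableAt (by norm_num))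
  have a := ((d'.mul (hf.mul hP)).clm (traceL m)).diff
  have b := ((d.mul ((hN.mul hf).sub (hf.mul hN))).clm (traceL m)).diff
  simp only [traceL_apply] at a b
  have h2 : (mvfderiv (𝓡 (2 * m - 1)) f q (ext y q) * (N q * f q - f q * N q)).trace = 2 := by
    have hr : N q * f q - f q * N q = wedge e₁ 0 + wedge e₂ v := by
      rw [← neg_sub, hF.lie_eq, neg_neg]; simp [wedge]
    have := metric_wedge hF.frame isPerp_zero hF.perp isPerp_zero hF.perp
    rw [hext, hr, hy.df]
    rw [metric] at this
    simp only [hF.unit, lform_zero_left] at this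
    linarith
  have c := (a.mul (mdifferentiableAt_const (c := (2 : ℝ)))).div b (by rw [h2]; norm_num)
  refine c.congr_of_eventuallyEq ?_
  have hne := b.continuousAt.eventually_ne (by rw [h2]; norm_num : _ ≠ (0 : ℝ))
  filter_upwards [H.eventually_mem hq, hne] with p hp hpne
  have := H.trace_dproj hp (ext y p)
  simp only [Pi.mul_apply, Pi.div_apply] at *
  rw [this]
  field_simp

end IsHopfPrincipalOn

/-! ### The structure equation and the shape operator -/

namespace IsHopfPrincipalOn

variable {f N : M → Mat m} {U : Set M} (H : IsHopfPrincipalOn f N U)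
  {q : M} (hq : q ∈ U) {e₁ e₂ v : Fin 2 ⊕ Fin m → ℝ}
include H hq

/-- The exterior derivative of the identity `tr (dP W P) = α η`, on vectors orthogonal to the
Reeb field: the curvature of the circle of real structures is a multiple of the Kähler form. -/
theorem ext_deriv_eq [IsManifold (𝓡 (2 * m - 1)) ∞ M] (hF : IsAdapted (f q) (N q) e₁ e₂ v)
    {y y' : TangentSpace (𝓡 (2 * m - 1)) q} {x₁ x₂ s x₁' x₂' s' : Fin 2 ⊕ Fin m → ℝ} {θ θ' : ℝ}
    (h : IsWeingarten f N q e₁ e₂ v y x₁ x₂ s θ)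
    (h' : IsWeingarten f N q e₁ e₂ v y' x₁' x₂' s' θ')
    (hx : lform x₂ v = 0) (hx' : lform x₂' v = 0) :
    reebCurvature f N q * (lform x₂' s - lform x₂ s') = lform x₂' x₁ - lform x₂ x₁' := by
  obtain ⟨ext, hext, hsym⟩ := exists_commuting_extension (n := 2 * m - 1) (F := Mat m) q
  obtain ⟨D, d, d'⟩ := hsym f (H.hypersurface.smooth q) y y'
  obtain ⟨E, k, k'⟩ := hsym _ (H.smooth_proj hq) y y'
  have ht : θ = 0 := by rw [H.theta_eq hq hF h, hx, mul_zero]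
  have ht' : θ' = 0 := by rw [H.theta_eq hq hF h', hx', mul_zero]
  subst ht ht'
  have hα := H.mdifferentiableAt_reebCurvature hq
  have key : ∀ z : TangentSpace (𝓡 (2 * m - 1)) q,
      (fun p => reebCurvature f N p • traceL m (mvfderiv (𝓡 (2 * m - 1)) f p (ext z p) *
        (N p * f p - f p * N p))) =ᶠ[𝓝 q]
      (fun p => traceL m (mvfderiv (𝓡 (2 * m - 1)) (fun p => proj (f p) (N p)) p (ext z p) *
        (f p * proj (f p) (N p))) + traceL m (mvfderiv (𝓡 (2 * m - 1))
        (fun p => proj (f p) (N p)) p (ext z p) * (f p * proj (f p) (N p)))) := by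
    intro z
    filter_upwards [H.eventually_mem hq] with p hp
    simp only [traceL_apply, H.trace_dproj hp, smul_eq_mul]
    ring
  have step : ∀ {z z' : TangentSpace (𝓡 (2 * m - 1)) q} {D E : Mat m}
      {x₁ x₂ s x₁' x₂' s' : Fin 2 ⊕ Fin m → ℝ},
      IsWeingarten f N q e₁ e₂ v z x₁ x₂ s 0 → IsWeingarten f N q e₁ e₂ v z' x₁' x₂' s' 0 →
      lform x₂ v = 0 → lform x₂' v = 0 →
      HasDerAlong (fun p => mvfderiv (𝓡 (2 * m - 1)) f p (ext z p)) q z' D →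
      HasDerAlong (fun p => mvfderiv (𝓡 (2 * m - 1)) (fun p => proj (f p) (N p)) p (ext z p))
        q z' E →
      2 * (E * (f q * proj (f q) (N q))).trace
         - reebCurvature f N q * (D * (N q * f q - f q * N q)).trace =
        2 * lform x₂ x₁' - reebCurvature f N q * 2 * lform x₂ s' := by
    intro z z' D E x₁ x₂ s x₁' x₂' s' h h' hx hx' d k
    have hf := H.hasDer_f q z'
    have hN := H.hasDer_N hq z'
    have hP := H.hasDer_proj hq hF h'.h₁ h'.h₂ h'.hv h'.df h'.hs h'.hsv h'.dN
    have hP0 := H.hasDer_proj hq hF h.h₁ h.h₂ h.hv h.df h.hs h.hsv h.dN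
    have a := (k.mul (hf.mul hP)).clm (traceL m)
    have b := (HasDerAlong.of_diff (y := z') hα).smul
      ((d.mul ((hN.mul hf).sub (hf.mul hN))).clm (traceL m))
    have c := ((a.add a).congr (key z)).unique b
    rw [hext, hP0.val, h.df, h'.df, h'.dN] at c
    generalize mvfderiv (𝓡 (2 * m - 1)) (reebCurvature f N) q z' = dα at c
    generalize reebCurvature f N q = α at c ⊢
    simp only [traceL_apply, trace_add, smul_eq_mul] at c
    have i1 : ((-tens x₂ e₁ - tens e₁ x₂ + (0 : ℝ) • (tens e₁ e₂ + tens e₂ e₁)) *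
        (f q * (-tens x₂' e₁ - tens e₁ x₂' + (0 : ℝ) • (tens e₁ e₂ + tens e₂ e₁)))).trace = 0 := by
      rw [hF.frame.eq, zero_smul]
      simp only [wedge, neg_sub, mul_add, add_mul, mul_sub, sub_mul, tens_mul_tens, add_zero,
        tens_neg_left, neg_mul, mul_neg,
        trace_neg, trace_add, trace_sub, trace_smul, trace_tens, smul_eq_mul,
        smul_mul_assoc, mul_smul_comm, hF.frame.e11, hF.frame.e12,
        hF.frame.e21, hF.frame.e22, hF.unit, hF.perp.e1x, hF.perp.xe1, hF.perp.e2x, hF.perp.xe2,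
        h.h₁.e1x, h.h₁.e2x, h.h₁.xe1, h.h₁.xe2, h.h₂.e1x, h.h₂.e2x, h.h₂.xe1, h.h₂.xe2,
        h'.h₁.e1x, h'.h₁.e2x, h'.h₁.xe1, h'.h₁.xe2, h'.h₂.e1x, h'.h₂.e2x, h'.h₂.xe1, h'.h₂.xe2]
      ring
    have i2 : ((-tens x₂ e₁ - tens e₁ x₂ + (0 : ℝ) • (tens e₁ e₂ + tens e₂ e₁)) *
        ((wedge e₁ x₁' + wedge e₂ x₂') * proj (f q) (N q))).trace = -lform x₂ x₁' := by
      rw [hF.proj_eq, zero_smul]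
      simp only [wedge, neg_sub, mul_add, add_mul, mul_sub, sub_mul, tens_mul_tens, add_zero,
        tens_neg_left, neg_mul, mul_neg,
        trace_neg, trace_add, trace_sub, trace_smul, trace_tens, smul_eq_mul,
        smul_mul_assoc, mul_smul_comm, hF.frame.e11, hF.frame.e12,
        hF.frame.e21, hF.frame.e22, hF.unit, hF.perp.e1x, hF.perp.xe1, hF.perp.e2x, hF.perp.xe2,
        h.h₁.e1x, h.h₁.e2x, h.h₁.xe1, h.h₁.xe2, h.h₂.e1x, h.h₂.e2x, h.h₂.xe1, h.h₂.xe2,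
        h'.h₁.e1x, h'.h₁.e2x, h'.h₁.xe1, h'.h₁.xe2, h'.h₂.e1x, h'.h₂.e2x, h'.h₂.xe1, h'.h₂.xe2]
      ring
    have i3 : ((wedge e₁ x₁ + wedge e₂ x₂) * (N q * (wedge e₁ x₁' + wedge e₂ x₂') +
        (wedge x₂' v - wedge e₁ s' - (0 : ℝ) • wedge e₂ v) * f q -
        (f q * (wedge x₂' v - wedge e₁ s' - (0 : ℝ) • wedge e₂ v) +
        (wedge e₁ x₁' + wedge e₂ x₂') * N q))).trace = -2 * lform x₂ s' := by
      rw [hF.eq, hF.frame.eq, zero_smul]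
      simp only [wedge, neg_sub, mul_add, add_mul, mul_sub, sub_mul, tens_mul_tens, sub_zero,
        tens_neg_left, neg_mul, mul_neg,
        trace_neg, trace_add, trace_sub, trace_smul, trace_tens, smul_eq_mul,
        smul_mul_assoc, mul_smul_comm, hF.frame.e11, hF.frame.e12,
        hF.frame.e21, hF.frame.e22, hF.unit, hF.perp.e1x, hF.perp.xe1, hF.perp.e2x, hF.perp.xe2,
        h.h₁.e1x, h.h₁.e2x, h.h₁.xe1, h.h₁.xe2, h.h₂.e1x, h.h₂.e2x, h.h₂.xe1, h.h₂.xe2,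
        h'.h₁.e1x, h'.h₁.e2x, h'.h₁.xe1, h'.h₁.xe2, h'.h₂.e1x, h'.h₂.e2x, h'.h₂.xe1, h'.h₂.xe2,
        h'.hs.e1x, h'.hs.e2x, h'.hs.xe1, h'.hs.xe2, h'.hsv, h'.hv, h.hv, hx, hx', lform_comm v]
      ring
    have i4 : ((wedge e₁ x₁ + wedge e₂ x₂) * (N q * f q - f q * N q)).trace = 0 := by
      rw [← neg_sub (f q * N q), hF.lie_eq, neg_neg]
      simp only [wedge, mul_add, add_mul, mul_sub, sub_mul, tens_mul_tens,
        trace_add, trace_sub, trace_smul, trace_tens, smul_eq_mul,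
        hF.frame.e12, hF.frame.e21, hF.frame.e22, hF.perp.e1x, hF.perp.xe1, hF.perp.e2x,
        hF.perp.xe2, h.h₁.e1x, h.h₁.e2x, h.h₁.xe1, h.h₁.xe2, h.h₂.e1x, h.h₂.e2x, h.h₂.xe1,
        h.h₂.xe2, hx, lform_comm v]
      ring
    rw [mul_add _ (f q * _) (_ * proj _ _), trace_add, i1, i2, i3, i4] at c
    linarith
  have A := step h h' hx hx' d k
  have B := step h' h hx' hx d' k'
  linarith

/-- The shape operator: `e₁ ∧ x₁ + e₂ ∧ x₂` is sent to `α⁻¹ (e₁ ∧ x₁) + α ⟨x₂, v⟩ (e₂ ∧ v)`. -/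
theorem smul_s_eq [IsManifold (𝓡 (2 * m - 1)) ∞ M] (hF : IsAdapted (f q) (N q) e₁ e₂ v)
    {y : TangentSpace (𝓡 (2 * m - 1)) q} {x₁ x₂ s : Fin 2 ⊕ Fin m → ℝ} {θ : ℝ}
    (h : IsWeingarten f N q e₁ e₂ v y x₁ x₂ s θ) : reebCurvature f N q • s = x₁ := by
  -- A test vector `e₂ ∧ w` with `w ⟂ v` lies in the kernel of the shape operator.
  have test : ∀ w, IsPerp e₁ e₂ w → lform w v = 0 →
      ∃ y', IsWeingarten f N q e₁ e₂ v y' 0 w 0 0 := by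
    intro w hw hwv
    obtain ⟨y', hy'⟩ := H.exists_df_eq hq hF isPerp_zero hw (by simp)
    obtain ⟨s', θ', h'⟩ := H.exists_isWeingarten_of hq hF isPerp_zero hw (by simp) hy'
    have ht' : θ' = 0 := by rw [H.theta_eq hq hF h', hwv, mul_zero]
    subst ht'
    obtain ⟨y'', hy''⟩ := H.exists_df_eq hq hF h'.hs isPerp_zero h'.hsv
    obtain ⟨s'', θ'', h''⟩ := H.exists_isWeingarten_of hq hF h'.hs isPerp_zero h'.hsv hy''
    have := H.shape_symm hq hF h' h''
    simp only [zero_mul, add_zero, lform_zero_left, hwv, mul_zero] at this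
    have := hF.frame.eq_zero h'.hs this
    subst this
    exact ⟨y', h'⟩
  -- On vectors `e₁ ∧ x₁` the claim is the structure equation paired with the test vectors.
  have pure : ∀ {y : TangentSpace (𝓡 (2 * m - 1)) q} {x₁ s : Fin 2 ⊕ Fin m → ℝ} {θ : ℝ},
      IsWeingarten f N q e₁ e₂ v y x₁ 0 s θ → reebCurvature f N q • s = x₁ := by
    intro y x₁ s θ h
    have hp : IsPerp e₁ e₂ (reebCurvature f N q • s - x₁) := (h.hs.smul _).sub h.h₁
    have hpv : lform (reebCurvature f N q • s - x₁) v = 0 := by simp [h.hsv, h.hv]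
    obtain ⟨y', h'⟩ := test _ hp hpv
    have := H.ext_deriv_eq hq hF h h' (by simp) hpv
    rw [← sub_eq_zero]
    refine hF.frame.eq_zero hp ?_
    simp only [lform_sub_left, lform_sub_right, lform_smul_left, lform_smul_right,
      lform_zero_left, lform_zero_right, lform_comm x₁ s] at this ⊢
    linarith
  obtain ⟨ya, hya⟩ := H.exists_df_eq hq hF h.h₁ isPerp_zero h.hv
  obtain ⟨sa, θa, ha⟩ := H.exists_isWeingarten_of hq hF h.h₁ isPerp_zero h.hv hya
  obtain ⟨y₀, h₀⟩ := H.exists_reeb hq hF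
  obtain ⟨yb, hb⟩ := test (x₂ - lform x₂ v • v) (h.h₂.sub (hF.perp.smul _))
    (by simp [hF.unit])
  have hsum : y = ya + (lform x₂ v • y₀ + yb) := by
    apply H.hypersurface.immersion q
    rw [map_add, map_add, map_smul, h.df, ha.df, h₀.df, hb.df]
    simp only [wedge, tens_sub_left, tens_sub_right, tens_smul_left, tens_smul_right,
      tens_zero_left, tens_zero_right]
    module
  have hl := h.lie
  have hlin : ∀ a b : Mat m, ⁅f q, ⁅f q, a + b⁆⁆ = ⁅f q, ⁅f q, a⁆⁆ + ⁅f q, ⁅f q, b⁆⁆ := by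
    intro a b; simp only [Ring.lie_def]; noncomm_ring
  have hsm : ∀ (c : ℝ) (a : Mat m), ⁅f q, ⁅f q, c • a⁆⁆ = c • ⁅f q, ⁅f q, a⁆⁆ := by
    intro c a
    simp only [Ring.lie_def, mul_smul_comm, smul_mul_assoc, mul_sub, sub_mul, smul_sub]
  rw [hsum, map_add, map_add, map_smul, hlin, hlin, hsm, ha.lie, h₀.lie, hb.lie] at hl
  have := hF.frame.wedge_inj ha.hs (y₁ := s) (x₂ := θa • v + (lform x₂ v * reebCurvature f N q) • v)
    (y₂ := θ • v) ((hF.perp.smul _).add (hF.perp.smul _)) h.hs (hF.perp.smul _) (by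
      rw [← hl]
      simp only [wedge, tens_add_left, tens_add_right, tens_smul_left, tens_smul_right,
        tens_zero_left, tens_zero_right]
      module)
  rw [← this.1]
  exact pure ha

end IsHopfPrincipalOn

/-! ### Covariant derivatives along the Reeb field -/

theorem flatDeriv_congr {f X Y Z : M → Mat m} {q : M} (h : Y =ᶠ[𝓝 q] Z) :
    flatDeriv f X Y q = flatDeriv f X Z q := by
  have : mvfderiv (𝓡 (2 * m - 1)) Y q = mvfderiv (𝓡 (2 * m - 1)) Z q := by
    ext1 y
    by_cases hd : MDifferentiableAt (𝓡 (2 * m - 1)) 𝓘(ℝ, Mat m) Z q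
    · exact ((HasDerAlong.of_diff hd).congr h).val
    · have hd' : ¬ MDifferentiableAt (𝓡 (2 * m - 1)) 𝓘(ℝ, Mat m) Y q :=
        fun h' => hd (h'.congr_of_eventuallyEq h.symm)
      simp [mvfderiv, mfderiv_zero_of_not_mdifferentiableAt hd,
        mfderiv_zero_of_not_mdifferentiableAt hd']
  rw [flatDeriv, flatDeriv, this]

theorem nabla_congr {f N X Y Z : M → Mat m} {q : M} (h : Y =ᶠ[𝓝 q] Z) :
    nabla f N X Y q = nabla f N X Z q := by
  simp only [nabla, ambientNabla, flatDeriv_congr h]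

theorem nabla_zero {f N X Y : M → Mat m} {q : M} (h : Y =ᶠ[𝓝 q] fun _ => 0) :
    nabla f N X Y q = 0 := by
  have : flatDeriv f X (fun _ => (0 : Mat m)) q = 0 := (HasDerAlong.const 0).val
  rw [nabla_congr h]
  simp [nabla, ambientNabla, this, metric, Ring.lie_def]

theorem nabla_neg {f N X Y : M → Mat m} {q : M} :
    nabla f N X (fun p => -Y p) q = -nabla f N X Y q := by
  have : flatDeriv f X (fun p => -Y p) q = -flatDeriv f X Y q := by
    unfold flatDeriv
    rw [mvfderiv_fun_neg]
    rfl
  have e : -⁅f q, ⁅f q, -flatDeriv f X Y q⁆⁆ = -(-⁅f q, ⁅f q, flatDeriv f X Y q⁆⁆) := by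
    simp only [Ring.lie_def]
    noncomm_ring
  rw [nabla, nabla, ambientNabla, ambientNabla, this, e, metric, metric, neg_mul, trace_neg]
  module

namespace IsHopfPrincipalOn

variable {f N : M → Mat m} {U : Set M} (H : IsHopfPrincipalOn f N U)
  {q : M} (hq : q ∈ U) {e₁ e₂ v : Fin 2 ⊕ Fin m → ℝ}
include H hq

/-- The covariant derivative of the Reeb field, and its flat derivative. -/
theorem deriv_reeb [IsManifold (𝓡 (2 * m - 1)) ∞ M] (hF : IsAdapted (f q) (N q) e₁ e₂ v)
    {Z : M → Mat m} {x₁ x₂ : Fin 2 ⊕ Fin m → ℝ}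
    (h₁ : IsPerp e₁ e₂ x₁) (h₂ : IsPerp e₁ e₂ x₂) (hv : lform x₁ v = 0)
    (hZ : Z q = wedge e₁ x₁ + wedge e₂ x₂) :
    flatDeriv f Z (reeb f N) q = wedge e₁ ((reebCurvature f N q * lform x₂ v) • v) +
        wedge e₂ (-((reebCurvature f N q)⁻¹ • x₁)) + wedge v x₁ + (-lform x₂ v) • wedge e₁ e₂ ∧
      nabla f N Z (reeb f N) q = -((reebCurvature f N q)⁻¹ • wedge e₂ x₁) := by
  obtain ⟨y, hy⟩ := H.exists_df_eq hq hF h₁ h₂ hv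
  obtain ⟨s, θ, h⟩ := H.exists_isWeingarten_of hq hF h₁ h₂ hv hy
  have hs : s = (reebCurvature f N q)⁻¹ • x₁ := by
    rw [← H.smul_s_eq hq hF h, smul_smul, inv_mul_cancel₀ (H.reeb_ne q hq), one_smul]
  have ht := H.theta_eq hq hF h
  have hf := H.hasDer_f q y
  have hN := H.hasDer_N hq y
  have hr : HasDerAlong (reeb f N) q y _ := ((hf.mul hN).sub (hN.mul hf)).neg
  have e1 : flatDeriv f Z (reeb f N) q = wedge e₁ ((reebCurvature f N q * lform x₂ v) • v) +
        wedge e₂ (-((reebCurvature f N q)⁻¹ • x₁)) + wedge v x₁ + (-lform x₂ v) • wedge e₁ e₂ := by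
    rw [flatDeriv_eq H.hypersurface (hy.trans hZ.symm), hr.val, h.df, h.dN, ← hs, ← ht,
      hF.eq, hF.frame.eq]
    simp only [wedge, neg_sub, mul_add, add_mul, mul_sub, sub_mul, mul_smul_comm, smul_mul_assoc,
      tens_mul_tens, hF.frame.e11, hF.frame.e12, hF.frame.e21, hF.frame.e22, hF.unit,
      hF.perp.e1x, hF.perp.xe1, hF.perp.e2x, hF.perp.xe2, smul_sub, smul_add,
      tens_smul_left, tens_smul_right, tens_neg_left, tens_neg_right,
      h.h₁.e1x, h.h₁.e2x, h.h₁.xe1, h.h₁.xe2, h.h₂.e1x, h.h₂.e2x, h.h₂.xe1, h.h₂.xe2,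
      h.hs.e1x, h.hs.e2x, h.hs.xe1, h.hs.xe2, h.hv, h.hsv, lform_comm v]
    module
  refine ⟨e1, ?_⟩
  have hp : IsPerp e₁ e₂ (-((reebCurvature f N q)⁻¹ • x₁)) := by
    simpa using h₁.smul (-(reebCurvature f N q)⁻¹)
  have hNq : N q = wedge e₁ v + wedge e₂ 0 := by rw [hF.eq]; simp [wedge]
  rw [nabla, ambientNabla, e1, hF.frame.neg_lie_lie (hF.perp.smul _) hp hF.perp h₁]
  have hm := metric_wedge hF.frame (hF.perp.smul (reebCurvature f N q * lform x₂ v)) hp hF.perp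
    isPerp_zero
  rw [hNq, hm]
  simp only [wedge, lform_smul_left, hF.unit, lform_zero_right, tens_smul_left, tens_smul_right,
    tens_neg_left, tens_neg_right, tens_zero_left, tens_zero_right]
  module

/-- The derivative, in the direction of the Reeb field, of a field of tangent vectors of the
quadric. -/
theorem exists_wedge_deriv (hF : IsAdapted (f q) (N q) e₁ e₂ v)
    {y : TangentSpace (𝓡 (2 * m - 1)) q} (hy : IsWeingarten f N q e₁ e₂ v y 0 v 0
      (reebCurvature f N q)) {V : M → Mat m} {D : Mat m} (hD : HasDerAlong V q y D)
    (hV : ∀ p ∈ U, V p ∈ tangentSet (f p)) {a b : Fin 2 ⊕ Fin m → ℝ}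
    (ha : IsPerp e₁ e₂ a) (hb : IsPerp e₁ e₂ b) (hVq : V q = wedge e₁ a + wedge e₂ b) :
    ∃ z₁ z₂, IsPerp e₁ e₂ z₁ ∧ IsPerp e₁ e₂ z₂ ∧
      D = wedge e₁ z₁ + wedge e₂ z₂ + wedge v a + (-lform v b) • wedge e₁ e₂ := by
  have hf := H.hasDer_f q y
  rw [hy.df] at hf
  have hDl := hD.mem_lieAlg (by
    filter_upwards [H.eventually_mem hq] with p hp using
      mem_lieAlg_of_mem_tangentSet (H.frame_lieAlg p) (hV p hp))
  have hST : -⁅f q, ⁅f q, D⁆⁆ ∈ tangentSet (f q) := by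
    refine ⟨⁅f q, D⁆, lie_mem_lieAlg (H.frame_lieAlg q) hDl, ?_⟩
    simp only [Ring.lie_def]
    noncomm_ring
  obtain ⟨z₁, z₂, k₁, k₂, hS⟩ := hF.frame.exists_wedge_of_mem hST
  refine ⟨z₁, z₂, k₁, k₂, ?_⟩
  have hb' := (hf.mul hD).sub (hD.mul hf)
  have h := ((hf.mul hb').sub (hb'.mul hf)).unique (hD.neg.congr (by
    filter_upwards [H.eventually_mem hq] with p hp
    obtain ⟨_, _, hFp⟩ := exists_isFrame (H.hypersurface.mem_quadric p)
    obtain ⟨x, y, hx, hy, e⟩ := hFp.exists_wedge_of_mem (hV p hp)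
    have := hFp.neg_lie_lie hx hy (isPerp_zero) isPerp_zero 0
    rw [show wedge _ x + wedge _ y + wedge 0 0 + (0 : ℝ) • wedge _ _ = V p by
      rw [e]; simp [wedge], ← e] at this
    rw [Ring.lie_def, Ring.lie_def] at this
    exact neg_eq_iff_eq_neg.mp this))
  simp only [Ring.lie_def] at hS
  have h' : D = -(f q * (f q * D - D * f q) - (f q * D - D * f q) * f q)
      - ((wedge e₁ 0 + wedge e₂ v) * (f q * V q - V q * f q)
          - (f q * V q - V q * f q) * (wedge e₁ 0 + wedge e₂ v))
      - (f q * ((wedge e₁ 0 + wedge e₂ v) * V q - V q * (wedge e₁ 0 + wedge e₂ v))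
          - ((wedge e₁ 0 + wedge e₂ v) * V q - V q * (wedge e₁ 0 + wedge e₂ v)) * f q) := by
    rw [← neg_eq_iff_eq_neg] at h
    refine h.symm.trans ?_
    noncomm_ring
  rw [hS, hVq, hF.frame.eq] at h'
  rw [h']
  simp only [wedge, neg_sub, neg_add, mul_add, add_mul, mul_sub, sub_mul, tens_mul_tens,
      tens_zero_left, tens_zero_right, zero_mul, mul_zero, sub_zero, zero_sub, add_zero, zero_add,
      smul_mul_assoc, mul_smul_comm, hF.frame.e11, hF.frame.e12,
      hF.frame.e21, hF.frame.e22, hF.unit, hF.perp.e1x, hF.perp.xe1, hF.perp.e2x, hF.perp.xe2,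
      ha.e1x, ha.e2x, ha.xe1, ha.xe2, hb.e1x, hb.e2x, hb.xe1, hb.xe2, lform_comm _ v]
  module

/-- The derivative of `P V + V P`, in the direction of the Reeb field; it reflects that the
circle of real structures rotates with speed `α` along the Reeb field. -/
theorem hasDer_proj_mul (hF : IsAdapted (f q) (N q) e₁ e₂ v)
    {y : TangentSpace (𝓡 (2 * m - 1)) q} (hy : IsWeingarten f N q e₁ e₂ v y 0 v 0
      (reebCurvature f N q)) {V : M → Mat m} {a b z₁ z₂ : Fin 2 ⊕ Fin m → ℝ}
    (ha : IsPerp e₁ e₂ a) (hb : IsPerp e₁ e₂ b) (hVq : V q = wedge e₁ a + wedge e₂ b)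
    (k₁ : IsPerp e₁ e₂ z₁) (k₂ : IsPerp e₁ e₂ z₂)
    (hD : HasDerAlong V q y
      (wedge e₁ z₁ + wedge e₂ z₂ + wedge v a + (-lform v b) • wedge e₁ e₂)) :
    HasDerAlong (fun p => proj (f p) (N p) * V p + V p * proj (f p) (N p)) q y
      (wedge e₁ (z₁ - reebCurvature f N q • b) + wedge e₂ (-(reebCurvature f N q • a)) +
        wedge v a) := by
  have hP := H.hasDer_proj hq hF hy.h₁ hy.h₂ hy.hv hy.df hy.hs hy.hsv hy.dN
  have h := (hP.mul hD).add (hD.mul hP)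
  refine ⟨h.diff, h.val.trans ?_⟩
  rw [hF.proj_eq, hVq]
  simp only [wedge, neg_sub, neg_add, mul_add, add_mul, mul_sub, sub_mul, tens_mul_tens,
      neg_mul, mul_neg, tens_neg_left, tens_neg_right, tens_smul_left, tens_smul_right,
      tens_sub_left, tens_sub_right, smul_sub, smul_add,
      smul_mul_assoc, mul_smul_comm, hF.frame.e11, hF.frame.e12,
      hF.frame.e21, hF.frame.e22, hF.unit, hF.perp.e1x, hF.perp.xe1, hF.perp.e2x, hF.perp.xe2,
      ha.e1x, ha.e2x, ha.xe1, ha.xe2, hb.e1x, hb.e2x, hb.xe1, hb.xe2, lform_comm _ v,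
      k₁.e1x, k₁.e2x, k₁.xe1, k₁.xe2, k₂.e1x, k₂.e2x, k₂.xe1, k₂.xe2]
  module

end IsHopfPrincipalOn

/-! ### The structure Jacobi operator on anti-invariant fields -/

/-- A tangent vector field of the hypersurface, orthogonal to the Reeb field, on which the real
structure fixing the normal is `-1`. -/
def IsAntiInvariantOn (f N X : M → Mat m) (U : Set M) : Prop :=
  ∀ p ∈ U, ∀ e₁ e₂ v, IsAdapted (f p) (N p) e₁ e₂ v →
    ∃ x, IsPerp e₁ e₂ x ∧ lform x v = 0 ∧ X p = wedge e₂ x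

namespace IsHopfPrincipalOn

variable {f N : M → Mat m} {U : Set M} (H : IsHopfPrincipalOn f N U)
  {q : M} (hq : q ∈ U) {e₁ e₂ v : Fin 2 ⊕ Fin m → ℝ}
include H hq

omit H hq in
theorem nabla_eq_of_wedge (hF : IsAdapted (f q) (N q) e₁ e₂ v) {X Y : M → Mat m}
    {a b x y : Fin 2 ⊕ Fin m → ℝ} (ha : IsPerp e₁ e₂ a) (hb : IsPerp e₁ e₂ b)
    (hx : IsPerp e₁ e₂ x) (hy : IsPerp e₁ e₂ y) (hav : lform a v = 0) {c : ℝ}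
    (h : flatDeriv f X Y q = wedge e₁ a + wedge e₂ b + wedge x y + c • wedge e₁ e₂) :
    nabla f N X Y q = wedge e₁ a + wedge e₂ b := by
  have hNq : N q = wedge e₁ v + wedge e₂ 0 := by rw [hF.eq]; simp [wedge]
  have hm := metric_wedge hF.frame ha hb hF.perp isPerp_zero
  rw [nabla, ambientNabla, h, hF.frame.neg_lie_lie ha hb hx hy, hNq, hm, hav]
  simp

/-- The derivative of an anti-invariant field along the Reeb field is tangent, and its invariant
component is `α J X`. -/
theorem deriv_antiInvariant [IsManifold (𝓡 (2 * m - 1)) ∞ M]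
    (hF : IsAdapted (f q) (N q) e₁ e₂ v)
    {y : TangentSpace (𝓡 (2 * m - 1)) q} (hy : IsWeingarten f N q e₁ e₂ v y 0 v 0
      (reebCurvature f N q)) {X : M → Mat m} (hX : IsAntiInvariantOn f N X U)
    (hXd : ∀ p ∈ U, MDifferentiableAt (𝓡 (2 * m - 1)) 𝓘(ℝ, Mat m) X p)
    {x : Fin 2 ⊕ Fin m → ℝ} (hx : IsPerp e₁ e₂ x) (hxv : lform x v = 0)
    (hXq : X q = wedge e₂ x) :
    ∃ z, IsPerp e₁ e₂ z ∧ lform z v = 0 ∧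
      HasDerAlong X q y (wedge e₁ (reebCurvature f N q • x) + wedge e₂ z) ∧
      flatDeriv f (reeb f N) X q = wedge e₁ (reebCurvature f N q • x) + wedge e₂ z ∧
      nabla f N (reeb f N) X q = wedge e₁ (reebCurvature f N q • x) + wedge e₂ z := by
  have hD := HasDerAlong.of_diff (y := y) (hXd q hq)
  have hXq' : X q = wedge e₁ 0 + wedge e₂ x := by rw [hXq]; simp [wedge]
  obtain ⟨z₁, z₂, k₁, k₂, e⟩ := H.exists_wedge_deriv hq hF hy hD (fun p hp => by
    obtain ⟨e₁, e₂, v, hFp⟩ := H.exists_isAdapted hp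
    obtain ⟨x, hx, -, e⟩ := hX p hp _ _ _ hFp
    have := hFp.frame.wedge_mem_tangentSet isPerp_zero hx
    rw [e]
    simpa [wedge] using this) isPerp_zero hx hXq'
  rw [e] at hD
  have hP := H.hasDer_proj_mul hq hF hy isPerp_zero hx hXq' k₁ k₂ hD
  -- `P X + X P = 0`, as `X` has no invariant component.
  have h0 := hP.unique ((HasDerAlong.const (0 : Mat m)).congr (by
    filter_upwards [H.eventually_mem hq] with p hp
    obtain ⟨e₁, e₂, v, hFp⟩ := H.exists_isAdapted hp
    obtain ⟨x, hx, -, e⟩ := hX p hp _ _ _ hFp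
    rw [e, hFp.proj_eq]
    simp only [wedge, mul_sub, sub_mul, neg_mul, mul_neg, tens_mul_tens, hFp.frame.e12,
      hFp.frame.e21, hx.e1x, hx.xe1]
    module))
  have hz₁ : z₁ = reebCurvature f N q • x := by
    have := hF.frame.wedge_inj (k₁.sub (hx.smul (reebCurvature f N q))) isPerp_zero isPerp_zero
      isPerp_zero (y₂ := 0) (by rw [← sub_eq_zero, ← h0]; simp [wedge])
    exact sub_eq_zero.mp this.1
  subst hz₁
  have hD' : HasDerAlong X q y (wedge e₁ (reebCurvature f N q • x) + wedge e₂ z₂) := by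
    rw [lform_comm v x, hxv] at hD
    simpa [wedge] using hD
  -- This is the derivative of `⟨X, ξ⟩ = 0`.
  have hz₂ : lform z₂ v = 0 := by
    have hf := H.hasDer_f q y
    have hN := H.hasDer_N hq y
    rw [hy.df] at hf
    rw [hy.dN] at hN
    have h := ((hD'.mul ((hN.mul hf).sub (hf.mul hN))).clm (traceL m)).unique
      ((HasDerAlong.const (0 : ℝ)).congr (by
        filter_upwards [H.eventually_mem hq] with p hp
        obtain ⟨e₁, e₂, v, hFp⟩ := H.exists_isAdapted hp
        obtain ⟨x, hx, hxv, e⟩ := hX p hp _ _ _ hFp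
        rw [e, ← neg_sub (f p * N p), hFp.lie_eq, neg_neg, traceL_apply]
        simp only [wedge, mul_sub, sub_mul, tens_mul_tens, trace_sub, trace_smul, trace_tens,
          smul_eq_mul, hFp.frame.e22, hFp.perp.e2x, hFp.perp.xe2, hx.e2x, hx.xe2, hxv,
          lform_comm v]
        ring))
    rw [← neg_sub (f q * N q), hF.lie_eq, neg_neg, hXq, hF.eq, hF.frame.eq] at h
    simp only [traceL_apply, wedge, neg_sub, mul_add, add_mul, mul_sub, sub_mul, tens_mul_tens,
      tens_neg_left, neg_mul, mul_neg, tens_zero_left, tens_zero_right, zero_mul, mul_zero,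
      trace_neg, trace_add, trace_sub, trace_smul, trace_tens, smul_eq_mul, trace_zero,
      tens_smul_left, tens_smul_right,
      smul_mul_assoc, mul_smul_comm, hF.frame.e11, hF.frame.e12,
      hF.frame.e21, hF.frame.e22, hF.unit, hF.perp.e1x, hF.perp.xe1, hF.perp.e2x, hF.perp.xe2,
      hx.e1x, hx.e2x, hx.xe1, hx.xe2, k₂.e1x, k₂.e2x, k₂.xe1, k₂.xe2, hxv, lform_comm v] at h
    ring_nf at h
    linarith
  have hr : mvfderiv (𝓡 (2 * m - 1)) f q y = reeb f N q := by
    rw [hy.df, hF.reeb_eq]; simp [wedge]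
  have e' : flatDeriv f (reeb f N) X q = wedge e₁ (reebCurvature f N q • x) + wedge e₂ z₂ := by
    rw [flatDeriv_eq H.hypersurface hr, hD'.val]
  refine ⟨z₂, k₂, hz₂, hD', e', ?_⟩
  exact nabla_eq_of_wedge hF (hx.smul _) k₂ isPerp_zero isPerp_zero (by simp [hxv])
    (c := 0) (by rw [e']; simp [wedge])

/-- The integral curves of the Reeb field are geodesics. -/
theorem nabla_reeb_reeb [IsManifold (𝓡 (2 * m - 1)) ∞ M] :
    nabla f N (reeb f N) (reeb f N) q = 0 := by
  obtain ⟨e₁, e₂, v, hF⟩ := H.exists_isAdapted hq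
  have := (H.deriv_reeb hq hF (Z := reeb f N) isPerp_zero hF.perp (by simp)
    (by rw [hF.reeb_eq]; simp [wedge])).2
  rw [this]
  simp [wedge]

/-- The term `∇_X ∇_ξ ξ` of the curvature vanishes, because `∇_ξ ξ = 0` on `U`. -/
theorem structureJacobi_eq [IsManifold (𝓡 (2 * m - 1)) ∞ M] (X : M → Mat m) :
    structureJacobi f N X q = -nabla f N (reeb f N) (nabla f N X (reeb f N)) q -
      nabla f N (bracket f X (reeb f N)) (reeb f N) q := by
  rw [structureJacobi, curvature, nabla_zero (Y := nabla f N (reeb f N) (reeb f N))]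
  · abel
  · filter_upwards [H.eventually_mem hq] with p hp using H.nabla_reeb_reeb hp

/-- On an anti-invariant field the structure Jacobi operator is `-1`. -/
theorem structureJacobi_antiInvariant [IsManifold (𝓡 (2 * m - 1)) ∞ M]
    {X : M → Mat m} (hX : IsAntiInvariantOn f N X U)
    (hXd : ∀ p ∈ U, MDifferentiableAt (𝓡 (2 * m - 1)) 𝓘(ℝ, Mat m) X p) :
    structureJacobi f N X q = -X q := by
  have hz : nabla f N (reeb f N) (nabla f N X (reeb f N)) q = 0 := by
    refine nabla_zero ?_
    filter_upwards [H.eventually_mem hq] with p hp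
    obtain ⟨e₁, e₂, v, hF⟩ := H.exists_isAdapted hp
    obtain ⟨x, hx, hxv, e⟩ := hX p hp _ _ _ hF
    rw [(H.deriv_reeb hp hF isPerp_zero hx (by simp) (by rw [e]; simp [wedge])).2]
    simp [wedge]
  obtain ⟨e₁, e₂, v, hF⟩ := H.exists_isAdapted hq
  obtain ⟨x, hx, hxv, e⟩ := hX q hq _ _ _ hF
  obtain ⟨y, hy⟩ := H.exists_reeb hq hF
  obtain ⟨z, k, hzv, -, hfl, -⟩ := H.deriv_antiInvariant hq hF hy hX hXd hx hxv e
  have hα := H.reeb_ne q hq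
  have hb : bracket f X (reeb f N) q =
      wedge e₁ (-(reebCurvature f N q) • x) + wedge e₂ (-(1 : ℝ) • z) := by
    rw [bracket, hfl, (H.deriv_reeb hq hF isPerp_zero hx (by simp) (by rw [e]; simp [wedge])).1,
      hxv]
    simp only [wedge, tens_smul_left, tens_smul_right, tens_zero_left, tens_zero_right,
      tens_neg_left, tens_neg_right]
    module
  rw [H.structureJacobi_eq hq, hz,
    (H.deriv_reeb hq hF (hx.smul _) (k.smul _) (by simp [hxv]) hb).2, e]
  simp only [wedge, tens_smul_left, tens_smul_right, ← smul_sub, smul_smul]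
  field_simp
  simp

/-- The contradiction: `∇_ξ R_ξ` maps an anti-invariant vector to a vector whose invariant
component is `-2 α J X`. -/
theorem not_isReebParallelAt [IsManifold (𝓡 (2 * m - 1)) ∞ M]
    {X : M → Mat m} (hX : IsAntiInvariantOn f N X U)
    (hXd : ∀ p ∈ U, MDifferentiableAt (𝓡 (2 * m - 1)) 𝓘(ℝ, Mat m) X p)
    (hYd : MDifferentiableAt (𝓡 (2 * m - 1)) 𝓘(ℝ, Mat m) (flatDeriv f (reeb f N) X) q)
    (hX0 : X q ≠ 0) :
    nabla f N (reeb f N) (structureJacobi f N X) q -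
      structureJacobi f N (nabla f N (reeb f N) X) q ≠ 0 := by
  obtain ⟨e₁, e₂, v, hF⟩ := H.exists_isAdapted hq
  obtain ⟨x, hx, hxv, e⟩ := hX q hq _ _ _ hF
  obtain ⟨y, hy⟩ := H.exists_reeb hq hF
  obtain ⟨z, k, hzv, hD, hfl, hnb⟩ := H.deriv_antiInvariant hq hF hy hX hXd hx hxv e
  have hα := H.reeb_ne q hq
  set Y := nabla f N (reeb f N) X
  have loc : ∀ p ∈ U, ∃ e₁ e₂ v x z, IsAdapted (f p) (N p) e₁ e₂ v ∧ IsPerp e₁ e₂ x ∧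
      lform x v = 0 ∧ X p = wedge e₂ x ∧ IsPerp e₁ e₂ z ∧
      Y p = wedge e₁ (reebCurvature f N p • x) + wedge e₂ z ∧
      flatDeriv f (reeb f N) X p = Y p := by
    intro p hp
    obtain ⟨e₁, e₂, v, hF⟩ := H.exists_isAdapted hp
    obtain ⟨x, hx, hxv, e⟩ := hX p hp _ _ _ hF
    obtain ⟨y, hy⟩ := H.exists_reeb hp hF
    obtain ⟨z, k, hzv, hD, hfl, hnb⟩ := H.deriv_antiInvariant hp hF hy hX hXd hx hxv e
    exact ⟨e₁, e₂, v, x, z, hF, hx, hxv, e, k, hnb, hfl.trans hnb.symm⟩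
  have hYd' : MDifferentiableAt (𝓡 (2 * m - 1)) 𝓘(ℝ, Mat m) Y q :=
    hYd.congr_of_eventuallyEq (by
      filter_upwards [H.eventually_mem hq] with p hp
      obtain ⟨_, _, _, _, _, -, -, -, -, -, -, h⟩ := loc p hp
      exact h.symm)
  have t1 : nabla f N (reeb f N) (structureJacobi f N X) q = -Y q := by
    rw [nabla_congr (Z := fun p => -X p), nabla_neg]
    filter_upwards [H.eventually_mem hq] with p hp using H.structureJacobi_antiInvariant hp hX hXd
  have hDY := HasDerAlong.of_diff (y := y) hYd'
  obtain ⟨z₁, z₂, k₁, k₂, eY⟩ := H.exists_wedge_deriv hq hF hy hDY (fun p hp => by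
    obtain ⟨e₁, e₂, v, x, z, hF, hx, hxv, e, k, hnb, -⟩ := loc p hp
    rw [hnb]
    exact hF.frame.wedge_mem_tangentSet (hx.smul _) k) (hx.smul _) k hnb
  rw [eY] at hDY
  have hPY := H.hasDer_proj_mul hq hF hy (hx.smul _) k hnb k₁ k₂ hDY
  have hf := H.hasDer_f q y
  rw [hy.df] at hf
  have hα' := HasDerAlong.of_diff (y := y) (H.mdifferentiableAt_reebCurvature hq)
  have hR := hα'.smul ((hf.mul hD).sub (hD.mul hf))
  -- The invariant component of `Y` is `α J X`, so `P Y + Y P = α [W, X]`.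
  have hPYeq := hPY.unique (hR.congr (by
    filter_upwards [H.eventually_mem hq] with p hp
    obtain ⟨e₁, e₂, v, x, z, hF, hx, hxv, e, k, hnb, -⟩ := loc p hp
    rw [hnb, e, hF.proj_eq, hF.frame.eq]
    simp only [wedge, mul_add, add_mul, mul_sub, sub_mul, neg_mul, mul_neg, tens_mul_tens,
      tens_smul_left, tens_smul_right, smul_mul_assoc, mul_smul_comm, smul_sub,
      hF.frame.e11, hF.frame.e22, hF.frame.e12, hF.frame.e21, hx.e1x, hx.xe1, hx.e2x, hx.xe2,
      k.e1x, k.e2x, k.xe1, k.xe2]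
    module))
  set α := reebCurvature f N q
  set u := mvfderiv (𝓡 (2 * m - 1)) (reebCurvature f N) q y
  have hz₁ : z₁ = u • x + (2 * α) • z := by
    have := hF.frame.wedge_inj (x₁ := z₁ - α • z) (x₂ := -(α • α • x))
      (y₁ := u • x + α • z) (y₂ := -(α • α • x)) (k₁.sub (k.smul _))
      (by simpa [smul_smul] using (hx.smul (-(α * α)))) ((hx.smul _).add (k.smul _))
      (by simpa [smul_smul] using (hx.smul (-(α * α)))) (by
        rw [← sub_eq_zero] at hPYeq ⊢
        rw [← hPYeq, e, hF.frame.eq]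
        simp only [wedge, mul_add, add_mul, mul_sub, sub_mul, neg_mul, mul_neg, tens_mul_tens,
          tens_smul_left, tens_smul_right, smul_mul_assoc, mul_smul_comm, smul_sub,
          tens_add_left, tens_add_right, tens_sub_left, tens_sub_right, tens_neg_left,
          tens_neg_right, tens_zero_left, tens_zero_right, zero_mul, mul_zero,
          hF.frame.e11, hF.frame.e22, hF.frame.e12, hF.frame.e21, hx.e1x, hx.xe1, hx.e2x, hx.xe2,
          k.e1x, k.e2x, k.xe1, k.xe2, hF.perp.e1x, hF.perp.e2x, hF.perp.xe1, hF.perp.xe2, hxv,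
          lform_comm v]
        module)
    rw [← sub_eq_zero, show z₁ - (u • x + (2 * α) • z) = (z₁ - α • z) - (u • x + α • z) by module,
      this.1, sub_self]
  have hz₁v : lform z₁ v = 0 := by rw [hz₁]; simp [hxv, hzv]
  have hr : mvfderiv (𝓡 (2 * m - 1)) f q y = reeb f N q := by
    rw [hy.df, hF.reeb_eq]; simp [wedge]
  have hTY := H.deriv_reeb hq hF (Z := Y) (hx.smul _) k (by simp [hxv]) hnb
  have hb : bracket f Y (reeb f N) q =
      wedge e₁ (-(1 : ℝ) • z₁) + wedge e₂ (-(1 : ℝ) • (x + z₂)) := by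
    rw [bracket, hTY.1, flatDeriv_eq H.hypersurface hr, hDY.val, hzv, lform_comm v z, hzv]
    simp only [wedge, tens_smul_left, tens_smul_right, tens_zero_left, tens_zero_right,
      tens_neg_left, tens_neg_right, tens_add_left, tens_add_right, smul_smul]
    rw [inv_mul_cancel₀ hα]
    module
  have hnn : nabla f N (reeb f N) (nabla f N Y (reeb f N)) q = -Y q := by
    rw [nabla_congr (Z := fun p => -X p), nabla_neg]
    filter_upwards [H.eventually_mem hq] with p hp
    obtain ⟨e₁, e₂, v, x, z, hF, hx, hxv, e, k, hnb, -⟩ := loc p hp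
    rw [(H.deriv_reeb hp hF (Z := Y) (hx.smul _) k (by simp [hxv]) hnb).2, e]
    have hα := H.reeb_ne p hp
    simp only [wedge, tens_smul_left, tens_smul_right, ← smul_sub, smul_smul]
    rw [inv_mul_cancel₀ hα, one_smul]
  intro h
  rw [t1, H.structureJacobi_eq hq, hnn,
    (H.deriv_reeb hq hF (k₁.smul _) ((hx.add k₂).smul _) (by simp [hz₁v]) hb).2, hnb] at h
  have := hF.frame.wedge_inj (x₁ := (2 * α) • x) (x₂ := (2 : ℝ) • z - α⁻¹ • z₁) (y₁ := 0) (y₂ := 0)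
    (hx.smul _) ((k.smul _).sub (k₁.smul _)) isPerp_zero isPerp_zero (by
      rw [← sub_eq_zero, ← neg_eq_zero, ← h]
      simp only [wedge, tens_smul_left, tens_smul_right, tens_zero_left, tens_zero_right,
        tens_sub_left, tens_sub_right]
      module)
  have hx0 : x = 0 := by
    have h2 := this.1
    rw [smul_eq_zero] at h2
    exact h2.resolve_left (by simpa using hα)
  rw [e, hx0] at hX0
  simp [wedge] at hX0

end IsHopfPrincipalOn

/-! ### Construction of anti-invariant fields -/

/-- On `U`, the function `A` has the derivative `B` along the Reeb field, and both `A` and `B` are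
differentiable there. -/
structure HasReebDerivOn (f N : M → Mat m) (U : Set M) (A B : M → Mat m) : Prop where
  diff : ∀ p ∈ U, MDifferentiableAt (𝓡 (2 * m - 1)) 𝓘(ℝ, Mat m) A p
  diff' : ∀ p ∈ U, MDifferentiableAt (𝓡 (2 * m - 1)) 𝓘(ℝ, Mat m) B p
  val : ∀ p ∈ U, ∀ y, mvfderiv (𝓡 (2 * m - 1)) f p y = reeb f N p →
    mvfderiv (𝓡 (2 * m - 1)) A p y = B p

namespace HasReebDerivOn

variable {f N : M → Mat m} {U : Set M} {A A' B B' : M → Mat m}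

theorem const (c : Mat m) : HasReebDerivOn f N U (fun _ => c) (fun _ => 0) where
  diff _ _ := mdifferentiableAt_const
  diff' _ _ := mdifferentiableAt_const
  val _ _ _ _ := (HasDerAlong.const c).val

theorem add (h : HasReebDerivOn f N U A A') (k : HasReebDerivOn f N U B B') :
    HasReebDerivOn f N U (fun p => A p + B p) (fun p => A' p + B' p) where
  diff p hp := (h.diff p hp).add (k.diff p hp)
  diff' p hp := (h.diff' p hp).add (k.diff' p hp)
  val p hp y hy := (HasDerAlong.add ⟨h.diff p hp, h.val p hp y hy⟩
    ⟨k.diff p hp, k.val p hp y hy⟩).val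

theorem sub (h : HasReebDerivOn f N U A A') (k : HasReebDerivOn f N U B B') :
    HasReebDerivOn f N U (fun p => A p - B p) (fun p => A' p - B' p) where
  diff p hp := (h.diff p hp).sub (k.diff p hp)
  diff' p hp := (h.diff' p hp).sub (k.diff' p hp)
  val p hp y hy := (HasDerAlong.sub ⟨h.diff p hp, h.val p hp y hy⟩
    ⟨k.diff p hp, k.val p hp y hy⟩).val

theorem neg (h : HasReebDerivOn f N U A A') :
    HasReebDerivOn f N U (fun p => -A p) (fun p => -A' p) where
  diff p hp := (h.diff p hp).neg
  diff' p hp := (h.diff' p hp).neg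
  val p hp y hy := (HasDerAlong.neg ⟨h.diff p hp, h.val p hp y hy⟩).val

theorem mul (h : HasReebDerivOn f N U A A') (k : HasReebDerivOn f N U B B') :
    HasReebDerivOn f N U (fun p => A p * B p) (fun p => A p * B' p + A' p * B p) where
  diff p hp := ((HasDerAlong.of_diff (y := 0) (h.diff p hp)).mul (.of_diff (k.diff p hp))).diff
  diff' p hp := (((HasDerAlong.of_diff (y := 0) (h.diff p hp)).mul (.of_diff (k.diff' p hp))).add
    ((HasDerAlong.of_diff (h.diff' p hp)).mul (.of_diff (k.diff p hp)))).diff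
  val p hp y hy := (HasDerAlong.mul ⟨h.diff p hp, h.val p hp y hy⟩
    ⟨k.diff p hp, k.val p hp y hy⟩).val

end HasReebDerivOn

/-- The extension of the element `Z` of `so(2, m)` to an anti-invariant field. -/
noncomputable def antiExtension (f N : M → Mat m) (Z : Mat m) (p : M) : Mat m :=
  complProj (f p) (N p) * Z * lineProj (f p) (N p) +
    lineProj (f p) (N p) * Z * complProj (f p) (N p)

omit [TopologicalSpace M] [ChartedSpace (EuclideanSpace ℝ (Fin (2 * m - 1))) M] in
theorem antiExtension_eq {f N : M → Mat m} {Z : Mat m} (hZ : Z ∈ lieAlg m) {p : M}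
    {e₁ e₂ v : Fin 2 ⊕ Fin m → ℝ} (hF : IsAdapted (f p) (N p) e₁ e₂ v) :
    antiExtension f N Z p =
      wedge e₂ (Z *ᵥ e₂ + lform e₁ (Z *ᵥ e₂) • e₁ - lform v (Z *ᵥ e₂) • v) := by
  have s2 : lform e₂ (Z *ᵥ e₂) = 0 := by
    have := lform_lieAlg hZ e₂ e₂
    rw [lform_comm] at this
    linarith
  rw [antiExtension, hF.complProj_eq, hF.lineProj_eq]
  simp only [wedge, mul_neg, neg_mul, mul_tens, tens_mul hZ, add_mul, sub_mul, mul_add, mul_sub,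
    one_mul, mul_one, tens_mul_tens, add_mulVec, sub_mulVec, one_mulVec, tens_mulVec,
    tens_add_left, tens_add_right, tens_sub_left, tens_sub_right, tens_smul_left,
    tens_smul_right, tens_neg_left, tens_neg_right, s2, lform_comm _ e₁, lform_comm _ v,
    lform_lieAlg hZ _ e₂, ← mulVec_mulVec]
  module

omit [TopologicalSpace M] [ChartedSpace (EuclideanSpace ℝ (Fin (2 * m - 1))) M] in
theorem antiExtension_isAntiInvariantOn (f N : M → Mat m) {Z : Mat m} (hZ : Z ∈ lieAlg m)
    (U : Set M) : IsAntiInvariantOn f N (antiExtension f N Z) U := by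
  intro p _ e₁ e₂ v hF
  have s2 : lform e₂ (Z *ᵥ e₂) = 0 := by
    have := lform_lieAlg hZ e₂ e₂
    rw [lform_comm] at this
    linarith
  refine ⟨_, ⟨?_, ?_⟩, ?_, antiExtension_eq hZ hF⟩
  · simp [hF.frame.e11, hF.perp.e1x]
  · simp [hF.frame.e21, hF.perp.e2x, s2]
  · simp [hF.unit, hF.perp.e1x, lform_comm _ v, hF.perp.xe1]

namespace IsHopfPrincipalOn

variable {f N : M → Mat m} {U : Set M} (H : IsHopfPrincipalOn f N U)
include H

theorem hasReebDerivOn_f : HasReebDerivOn f N U f (reeb f N) where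
  diff p _ := (H.hasDer_f p 0).diff
  diff' p hp := (((H.hasDer_f p 0).mul (H.hasDer_N hp 0)).sub
    ((H.hasDer_N hp 0).mul (H.hasDer_f p 0))).neg.diff
  val _ _ _ hy := hy

theorem hasReebDerivOn_N [IsManifold (𝓡 (2 * m - 1)) ∞ M] :
    HasReebDerivOn f N U N (fun p => -(reebCurvature f N p • reeb f N p)) where
  diff p hp := (H.hasDer_N hp 0).diff
  diff' p hp := ((HasDerAlong.of_diff (y := 0) (H.mdifferentiableAt_reebCurvature hp)).smul
    (.of_diff (H.hasReebDerivOn_f.diff' p hp))).neg.diff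
  val p hp y hy := by
    obtain ⟨e₁, e₂, v, hF⟩ := H.exists_isAdapted hp
    obtain ⟨y₀, h₀⟩ := H.exists_reeb hp hF
    obtain rfl : y = y₀ := H.hypersurface.immersion p (by
      rw [hy, h₀.df, hF.reeb_eq]; simp [wedge])
    rw [h₀.dN, hF.reeb_eq]
    simp [wedge]

theorem exists_hasReebDerivOn_antiExtension [IsManifold (𝓡 (2 * m - 1)) ∞ M] (Z : Mat m) :
    ∃ B, HasReebDerivOn f N U (antiExtension f N Z) B := by
  have hf := H.hasReebDerivOn_f
  have hN := H.hasReebDerivOn_N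
  have hc := ((HasReebDerivOn.const 1).add (hf.mul hf)).mul
    ((HasReebDerivOn.const 1).sub (hN.mul hN))
  have hl := ((hf.mul (hN.mul hN)).mul hf).neg
  have hZ := HasReebDerivOn.const (f := f) (N := N) (U := U) Z
  exact ⟨_, ((hc.mul hZ).mul hl).add ((hl.mul hZ).mul hc)⟩

variable {q : M} (hq : q ∈ U)
include hq

theorem smooth_antiExtension (Z : Mat m) :
    ContMDiffAt (𝓡 (2 * m - 1)) 𝓘(ℝ, Mat m) ∞ (antiExtension f N Z) q := by
  have hf := H.hypersurface.smooth q
  have hN := H.smooth_N hq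
  have hc : ContMDiffAt (𝓡 (2 * m - 1)) 𝓘(ℝ, Mat m) ∞ (fun p => complProj (f p) (N p)) q :=
    contMDiffAt_mul (contMDiffAt_const.add (contMDiffAt_mul hf hf))
      (contMDiffAt_const.sub (contMDiffAt_mul hN hN))
  have hl : ContMDiffAt (𝓡 (2 * m - 1)) 𝓘(ℝ, Mat m) ∞ (fun p => lineProj (f p) (N p)) q :=
    contDiff_neg.comp_contMDiffAt (contMDiffAt_mul (contMDiffAt_mul hf (contMDiffAt_mul hN hN)) hf)
  exact (contMDiffAt_mul (contMDiffAt_mul hc contMDiffAt_const) hl).add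
    (contMDiffAt_mul (contMDiffAt_mul hl contMDiffAt_const) hc)

theorem not_reebParallel [IsManifold (𝓡 (2 * m - 1)) ∞ M] (hm : 2 ≤ m) :
    ¬ IsReebParallelAt f N q := by
  intro hR
  obtain ⟨e₁, e₂, v, hF⟩ := H.exists_isAdapted hq
  obtain ⟨x, hx0, hx, hvx⟩ := exists_isPerp hm e₁ e₂ v
  have hZ := wedge_mem_lieAlg e₂ x
  set X := antiExtension f N (wedge e₂ x)
  have hX : IsAntiInvariantOn f N X U := antiExtension_isAntiInvariantOn f N hZ U
  obtain ⟨B, hB⟩ := H.exists_hasReebDerivOn_antiExtension (wedge e₂ x)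
  have hT : IsTangentFieldNear f X q := by
    filter_upwards [H.eventually_mem hq] with p hp
    refine ⟨H.smooth_antiExtension hp _, ?_⟩
    obtain ⟨e₁, e₂, v, hF⟩ := H.exists_isAdapted hp
    obtain ⟨x, hx, hxv, e⟩ := hX p hp _ _ _ hF
    obtain ⟨y, hy⟩ := H.exists_df_eq hp hF isPerp_zero hx (by simp)
    exact ⟨y, by rw [hy, e]; simp [wedge]⟩
  have hYd : MDifferentiableAt (𝓡 (2 * m - 1)) 𝓘(ℝ, Mat m) (flatDeriv f (reeb f N) X) q := by
    refine (hB.diff' q hq).congr_of_eventuallyEq ?_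
    filter_upwards [H.eventually_mem hq] with p hp
    obtain ⟨e₁, e₂, v, hF⟩ := H.exists_isAdapted hp
    obtain ⟨y, hy⟩ := H.exists_reeb hp hF
    have hr : mvfderiv (𝓡 (2 * m - 1)) f p y = reeb f N p := by
      rw [hy.df, hF.reeb_eq]; simp [wedge]
    rw [flatDeriv_eq H.hypersurface hr, hB.val p hp y hr]
  have hX0 : X q ≠ 0 := by
    change antiExtension f N (wedge e₂ x) q ≠ 0
    rw [antiExtension_eq hZ hF]
    intro h
    have he : wedge e₂ x *ᵥ e₂ = x := by
      simp [wedge, sub_mulVec, tens_mulVec, hF.frame.e22, hx.xe2]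
    rw [he, hx.e1x, hvx] at h
    have := hF.frame.wedge_inj (x₁ := 0) (y₁ := 0) (y₂ := 0) isPerp_zero hx isPerp_zero
      isPerp_zero (by simpa [wedge] using h)
    exact hx0 this.2
  exact H.not_isReebParallelAt hq hX hB.diff hYd hX0 (hR X hT)

end IsHopfPrincipalOn

end Hypersurface

end ComplexHyperbolicQuadric

theorem mainTheorem4 (m : ℕ) (hm : 3 ≤ m) {M : Type*} [TopologicalSpace M] [Nonempty M]
    [ChartedSpace (EuclideanSpace ℝ (Fin (2 * m - 1))) M]
    [IsManifold (𝓡 (2 * m - 1)) ∞ M]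
    (f : M → Mat m) (hf : IsRealHypersurface f) :
    ¬ (∀ p : M, ∃ (U : Set M) (N : M → Mat m), IsOpen U ∧ p ∈ U ∧ IsUnitNormalOn f N U ∧
        ∀ q ∈ U, IsHopfAt f N q ∧ reebCurvature f N q ≠ 0 ∧ IsReebParallelAt f N q ∧
          IsPrincipal (f q) (N q)) := by
  intro h
  obtain ⟨p⟩ := ‹Nonempty M›
  obtain ⟨U, N, hU, hp, hN, hall⟩ := h p
  have H : IsHopfPrincipalOn f N U := ⟨hf, hU, hN, fun q hq => (hall q hq).1,
    fun q hq => (hall q hq).2.1, fun q hq => (hall q hq).2.2.2⟩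
  exact H.not_reebParallel hp (by omega) (hall p hp).2.2.1
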